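/- **Notation.** For a path $g$ on $[0,T]$ put $\delta g_{st}=g_t-g_s$; for a two-index map $g$ put $\delta g_{sut}=g_{st}-g_{su}-g_{ut}$. For $q>0$, a compact interval $J$ and a map $g$ defined on $\{(s,t)\in J^2: s\le t\}$ with values in a finite-dimensional normed space, let $\|g\|_{\bar V^q_2(J)}=\sup\big(\sum_i|g_{t_it_{i+1}}|^q\big)^{1/q}$, the supremum being over all finite sequences $t_0\le t_1\le\dots\le t_n$ in $J$. Write $g\in V^q_2(J)$ if this is finite and $\omega_g(s,t):=\|g\|^q_{\bar V^q_2([s,t])}$ is regular, i.e. tends to $0$ as $|t-s|\to0$; write $g\in V^q_{2,\mathrm{loc}}([0,T])$ if $[0,T]$ is covered by countably many intervals $I_k\subset[0,T]$ with $g\in V^q_2(I_k)$ for every $k$ (taking the $I_k$ compact makes no difference); and, for a path $g$, write $g\in V^q_1([0,T])$ if $\delta g\in V^q_2([0,T])$. Let $T>0$, $N\ge1$ and $2\le p<3$. A *continuous $N$-dimensional $p$-variation rough path* on $[0,T]$ is a pair $\mathbb X=(\mathbb X^1,\mathbb X^2)\in V^p_2([0,T];\mathbb R^N)\times V^{p/2}_2([0,T];\mathbb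 R^{N\times N})$ such that $\delta\mathbb X^{2,ij}_{sut}=\mathbb X^{1,i}_{su}\mathbb X^{1,j}_{ut}$ for all $0\le s<u<t\le T$ and all $i,j$. It is *geometric* if there are smooth paths $x^n:[0,T]\to\mathbb R^N$ such that $\mathbb X^{n,1}_{st}=\delta x^n_{st}$ and $\mathbb X^{n,2,ij}_{st}=\int_s^t\delta x^{n,i}_{su}\,\mathrm dx^{n,j}_u$ satisfy $\|\mathbb X^{n,1}-\mathbb X^1\|_{\bar V^p_2([0,T])}\to0$ and $\|\mathbb X^{n,2}-\mathbb X^2\|_{\bar V^{p/2}_2([0,T])}\to0$ as $n\to\infty$. For differentiable $f:\mathbb R\to\mathcal L(\mathbb R^N,\mathbb R)$ with components $f_i(\xi)=f(\xi)e_i$ put $f_{2,ij}(\xi)=f_i(\xi)f_j'(\xi)$. A pair $(y,m)$ with $y\in V^p_1([0,T];\mathbb R_{\ge0})$ and $m\in V^1_1([0,T];\mathbb R_{\ge0})$ is a *solution* of the rough differential equation $\mathrm dy=f(y)\,\mathrm d\mathbb X+\mathrm dm$ reflected at $0$, with initial condition $a$, if * there is $y^\natural\in V^{p/3}_{2,\mathrm{loc}}([0,T];\mathbb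 R)$ such that, for all $0\le s\le t\le T$, $$\delta y_{st}=\sum_i f_i(y_s)\,\mathbb X^{1,i}_{st}+\sum_{i,j}f_{2,ij}(y_s)\,\mathbb X^{2,ij}_{st}+\delta m_{st}+y^\natural_{st};$$ * $y_0=a$; * $m_t=\mathrm dm([0,t])$ for a finite positive Borel measure $\mathrm dm$, and $m_t=\int_0^t\mathbf 1_{\{y_u=0\}}\,\mathrm dm_u$ for all $t\in[0,T]$, where $\int_0^t$ denotes the integral over $(0,t]$. **Theorem.** Let $T>0$, $a>0$, $N\ge1$ and $2\le p<3$. Let $f:\mathbb R\to\mathcal L(\mathbb R^N,\mathbb R)$ be three times differentiable, bounded and with bounded derivatives of orders $1,2,3$, and let $\mathbb X$ be a continuous geometric $N$-dimensional $p$-variation rough path on $[0,T]$. Then there is exactly one solution $(y,m)$ on $[0,T]$ with initial condition $a$: a solution exists, and any two solutions coincide on $[0,T]$. -/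

import Mathlib

open Set Filter Topology MeasureTheory
open scoped ENNReal ContDiff

namespace ReflectedRDE

/-! Paths and two-index maps on `[a, b]` are represented by functions on all of `ℝ`, of which only
the values at points of `[a, b]` (with `s ≤ t` for two-index maps) are ever used. -/

section Variation

variable {E : Type*} [NormedAddCommGroup E]

/-- The increment `(δg)_{st} = g_t - g_s` of a path. -/
def incr (g : ℝ → E) : ℝ → ℝ → E := fun s t => g t - g s

/-- The increment `(δg)_{sut} = g_{st} - g_{su} - g_{ut}` of a two-index map. -/
def incr₂ (g : ℝ → ℝ → E) : ℝ → ℝ → ℝ → E := fun s u t => g s t - g s u - g u t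

/-- The map `ω_g(a, b) = sup ∑ᵢ |g_{tᵢ tᵢ₊₁}|^q`, the supremum being over the finite nondecreasing
sequences in `[a, b]`; it is the `q`-th power of the `q`-variation norm of `g` on `[a, b]`. -/
noncomputable def varControl (q : ℝ) (g : ℝ → ℝ → E) (a b : ℝ) : ℝ≥0∞ :=
  ⨆ P : ℕ × {u : ℕ → ℝ // Monotone u ∧ ∀ i, u i ∈ Icc a b},
    ∑ i ∈ Finset.range P.1, ‖g (P.2.1 i) (P.2.1 (i + 1))‖ₑ ^ q

/-- The `q`-variation norm of a two-index map on `[a, b]`. -/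
noncomputable def varNorm (q : ℝ) (g : ℝ → ℝ → E) (a b : ℝ) : ℝ≥0∞ :=
  varControl q g a b ^ (1 / q)

/-- A two-index map `w` is regular on `[a, b]` if `w(s, t) → 0` as `|t - s| → 0`, `s ≤ t` in
`[a, b]`. -/
def IsRegular (w : ℝ → ℝ → ℝ≥0∞) (a b : ℝ) : Prop :=
  ∀ ε : ℝ≥0∞, 0 < ε → ∃ η : ℝ, 0 < η ∧
    ∀ s ∈ Icc a b, ∀ t ∈ Icc a b, s ≤ t → t - s < η → w s t < ε

/-- The space `V^q_2([a, b]; E)`: two-index maps of finite `q`-variation whose control `ω_g` is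
regular. -/
structure MemV₂ (q : ℝ) (g : ℝ → ℝ → E) (a b : ℝ) : Prop where
  finite : varNorm q g a b < ⊤
  regular : IsRegular (varControl q g) a b

/-- The space `V^q_1([a, b]; E)`: paths `g` with `δg ∈ V^q_2([a, b]; E)`. -/
def MemV₁ (q : ℝ) (g : ℝ → E) (a b : ℝ) : Prop := MemV₂ q (incr g) a b

/-- The space `V^q_{2,loc}([a, b]; E)`: two-index maps that belong to `V^q_2(I_k; E)` for all the
members of some countable covering `(I_k)` of `[a, b]` by subintervals. As every interval is a
countable union of compact intervals, and membership in `V^q_2` passes to subintervals, it makes no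
difference that the `I_k` are taken compact here. -/
def MemV₂loc (q : ℝ) (g : ℝ → ℝ → E) (a b : ℝ) : Prop :=
  ∃ c d : ℕ → ℝ, (∀ k, Icc (c k) (d k) ⊆ Icc a b) ∧ Icc a b ⊆ ⋃ k, Icc (c k) (d k) ∧
    ∀ k, MemV₂ q g (c k) (d k)

end Variation

section RoughPaths

variable {N : ℕ}

/-- `(X₁, X₂)` is a continuous `N`-dimensional `p`-variation rough path on `[0, T]`. -/
structure IsRoughPath (p T : ℝ) (X₁ : ℝ → ℝ → EuclideanSpace ℝ (Fin N))
    (X₂ : ℝ → ℝ → EuclideanSpace ℝ (Fin N × Fin N)) : Prop where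
  mem₁ : MemV₂ p X₁ 0 T
  mem₂ : MemV₂ (p / 2) X₂ 0 T
  chen : ∀ s u t : ℝ, 0 ≤ s → s < u → u < t → t ≤ T → ∀ i j : Fin N,
    incr₂ X₂ s u t (i, j) = X₁ s u i * X₁ u t j

/-- `(X₁, X₂)` is on `[0, T]` the smooth rough path above the smooth path `x`. -/
structure IsSmoothLift (T : ℝ) (x : ℝ → EuclideanSpace ℝ (Fin N))
    (X₁ : ℝ → ℝ → EuclideanSpace ℝ (Fin N))
    (X₂ : ℝ → ℝ → EuclideanSpace ℝ (Fin N × Fin N)) : Prop where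
  smooth : ContDiffOn ℝ ∞ x (Icc 0 T)
  level₁ : ∀ s t : ℝ, 0 ≤ s → s ≤ t → t ≤ T → X₁ s t = incr x s t
  level₂ : ∀ s t : ℝ, 0 ≤ s → s ≤ t → t ≤ T → ∀ i j : Fin N,
    X₂ s t (i, j) = ∫ u in s..t, (incr x s u) i * derivWithin (fun v => x v j) (Icc 0 T) u

/-- `(X₁, X₂)` is a continuous geometric `p`-variation rough path: a rough path that is the limit,
in the `p`-variation topology, of smooth rough paths. -/
structure IsGeometricRoughPath (p T : ℝ) (X₁ : ℝ → ℝ → EuclideanSpace ℝ (Fin N))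
    (X₂ : ℝ → ℝ → EuclideanSpace ℝ (Fin N × Fin N)) : Prop where
  isRoughPath : IsRoughPath p T X₁ X₂
  approx : ∃ (x : ℕ → ℝ → EuclideanSpace ℝ (Fin N))
    (Z₁ : ℕ → ℝ → ℝ → EuclideanSpace ℝ (Fin N))
    (Z₂ : ℕ → ℝ → ℝ → EuclideanSpace ℝ (Fin N × Fin N)),
    (∀ n, IsSmoothLift T (x n) (Z₁ n) (Z₂ n)) ∧
    Tendsto (fun n => varNorm p (Z₁ n - X₁) 0 T) atTop (𝓝 0) ∧
    Tendsto (fun n => varNorm (p / 2) (Z₂ n - X₂) 0 T) atTop (𝓝 0)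

end RoughPaths

section Equation

variable {N : ℕ}

/-- The class `C_b^3`: three times differentiable functions on `ℝ` which are bounded together with
their derivatives of order at most three. -/
structure IsCb3 {F : Type*} [NormedAddCommGroup F] [NormedSpace ℝ F] (f : ℝ → F) : Prop where
  differentiable : ∀ k < 3, Differentiable ℝ (iteratedDeriv k f)
  bounded : ∀ k ≤ 3, ∃ C : ℝ, ∀ ξ, ‖iteratedDeriv k f ξ‖ ≤ C

/-- The component `f_i(ξ) = f(ξ) e_i` of `f : ℝ → L(ℝ^N, ℝ)`. -/
noncomputable def comp (f : ℝ → EuclideanSpace ℝ (Fin N) →L[ℝ] ℝ) (i : Fin N) : ℝ → ℝ :=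
  fun ξ => f ξ (EuclideanSpace.single i 1)

/-- The second order coefficient `f_{2,ij}(ξ) = f_i(ξ) f_j'(ξ)`, which goes with
`X^{2,ij} = ∫ δx^i dx^j`. -/
noncomputable def comp₂ (f : ℝ → EuclideanSpace ℝ (Fin N) →L[ℝ] ℝ) (i j : Fin N) : ℝ → ℝ :=
  fun ξ => comp f i ξ * deriv (comp f j) ξ

/-- `(y, m)` solves on `[0, T]` the equation `dy = f(y) dX + dm`, `y dm = 0`, `y ≥ 0`, reflected at
`0`, with initial condition `a`. The finite measure `μ` is the measure `dm`, with
`m_t = m([0, t])`. -/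
structure IsSolution (p T a : ℝ) (f : ℝ → EuclideanSpace ℝ (Fin N) →L[ℝ] ℝ)
    (X₁ : ℝ → ℝ → EuclideanSpace ℝ (Fin N))
    (X₂ : ℝ → ℝ → EuclideanSpace ℝ (Fin N × Fin N)) (y m : ℝ → ℝ) : Prop where
  mem_y : MemV₁ p y 0 T
  nonneg_y : ∀ t ∈ Icc 0 T, 0 ≤ y t
  mem_m : MemV₁ 1 m 0 T
  nonneg_m : ∀ t ∈ Icc 0 T, 0 ≤ m t
  expansion : ∃ r : ℝ → ℝ → ℝ, MemV₂loc (p / 3) r 0 T ∧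
    ∀ s t : ℝ, 0 ≤ s → s ≤ t → t ≤ T →
      incr y s t = ∑ i, comp f i (y s) * X₁ s t i + ∑ i, ∑ j, comp₂ f i j (y s) * X₂ s t (i, j)
        + incr m s t + r s t
  initial : y 0 = a
  reflection : ∃ μ : Measure ℝ, IsFiniteMeasure μ ∧
    (∀ t ∈ Icc 0 T, m t = μ.real (Icc 0 t)) ∧
    ∀ t ∈ Icc 0 T, m t = ∫ u in (0 : ℝ)..t, {v : ℝ | y v = 0}.indicator (fun _ => (1 : ℝ)) u ∂μ

end Equation

end ReflectedRDE

namespace ReflectedRDE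

/-- A control on `[a, b]`: a nonnegative superadditive function of `s ≤ t`, regular at the
diagonal. -/
structure IsControl (ϖ : ℝ → ℝ → ℝ) (a b : ℝ) : Prop where
  nonneg : ∀ s t, a ≤ s → s ≤ t → t ≤ b → 0 ≤ ϖ s t
  add_le : ∀ s u t, a ≤ s → s ≤ u → u ≤ t → t ≤ b → ϖ s u + ϖ u t ≤ ϖ s t
  regular : ∀ ε : ℝ, 0 < ε → ∃ η : ℝ, 0 < η ∧
    ∀ s t, a ≤ s → s ≤ t → t ≤ b → t - s ≤ η → ϖ s t ≤ ε

namespace IsControl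

variable {ϖ ϖ' : ℝ → ℝ → ℝ} {a b : ℝ}

lemma self (h : IsControl ϖ a b) {s : ℝ} (h1 : a ≤ s) (h2 : s ≤ b) : ϖ s s = 0 := by
  have := h.nonneg s s h1 le_rfl h2
  have := h.add_le s s s h1 le_rfl le_rfl h2
  linarith

lemma mono (h : IsControl ϖ a b) {s s' t' t : ℝ} (h1 : a ≤ s) (h2 : s ≤ s') (h3 : s' ≤ t')
    (h4 : t' ≤ t) (h5 : t ≤ b) : ϖ s' t' ≤ ϖ s t := by
  have e1 := h.add_le s s' t h1 h2 (h3.trans h4) h5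
  have e2 := h.add_le s' t' t (h1.trans h2) h3 h4 h5
  have e3 := h.nonneg s s' h1 h2 (by linarith)
  have e4 := h.nonneg t' t (by linarith) h4 h5
  linarith

lemma restrict (h : IsControl ϖ a b) {c d : ℝ} (h1 : a ≤ c) (h2 : d ≤ b) : IsControl ϖ c d where
  nonneg s t x y z := h.nonneg s t (h1.trans x) y (z.trans h2)
  add_le s u t x y z w := h.add_le s u t (h1.trans x) y z (w.trans h2)
  regular ε hε := by
    obtain ⟨η, h3, h4⟩ := h.regular ε hε
    exact ⟨η, h3, fun s t x y z w => h4 s t (h1.trans x) y (z.trans h2) w⟩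

lemma add (h : IsControl ϖ a b) (h' : IsControl ϖ' a b) :
    IsControl (fun s t => ϖ s t + ϖ' s t) a b where
  nonneg s t x y z := add_nonneg (h.nonneg s t x y z) (h'.nonneg s t x y z)
  add_le s u t x y z w := by
    have := h.add_le s u t x y z w
    have := h'.add_le s u t x y z w
    linarith
  regular ε hε := by
    obtain ⟨η, h3, h4⟩ := h.regular (ε / 2) (by positivity)
    obtain ⟨η', h3', h4'⟩ := h'.regular (ε / 2) (by positivity)
    refine ⟨min η η', by positivity, fun s t x y z w => ?_⟩
    have := h4 s t x y z (w.trans (min_le_left _ _))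
    have := h4' s t x y z (w.trans (min_le_right _ _))
    linarith

lemma const_mul (h : IsControl ϖ a b) {C : ℝ} (hC : 0 ≤ C) :
    IsControl (fun s t => C * ϖ s t) a b where
  nonneg s t x y z := mul_nonneg hC (h.nonneg s t x y z)
  add_le s u t x y z w := by
    have := mul_le_mul_of_nonneg_left (h.add_le s u t x y z w) hC
    linarith
  regular ε hε := by
    obtain ⟨η, h3, h4⟩ := h.regular (ε / (C + 1)) (by positivity)
    refine ⟨η, h3, fun s t x y z w => ?_⟩
    have h5 := h4 s t x y z w
    have h6 : ϖ s t * (C + 1) ≤ ε := by rwa [le_div_iff₀ (by positivity)] at h5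
    have := h.nonneg s t x y z
    linarith

/-- The increments of a continuous nondecreasing path form a control. -/
lemma of_monotoneOn {g : ℝ → ℝ} (hm : MonotoneOn g (Icc a b)) (hc : ContinuousOn g (Icc a b)) :
    IsControl (fun s t => g t - g s) a b where
  nonneg s t x y z := sub_nonneg.2 (hm ⟨x, y.trans z⟩ ⟨x.trans y, z⟩ y)
  add_le s u t x y z w := by linarith
  regular ε hε := by
    have huc := isCompact_Icc.uniformContinuousOn_of_continuous hc
    obtain ⟨δ, hδ, h⟩ := Metric.uniformContinuousOn_iff.1 huc ε hε
    refine ⟨δ / 2, by positivity, fun s t x y z w => ?_⟩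
    have := h t ⟨x.trans y, z⟩ s ⟨x, y.trans z⟩ (by
      rw [Real.dist_eq, abs_of_nonneg (by linarith)]; linarith)
    rw [Real.dist_eq] at this
    exact (le_abs_self _).trans this.le

lemma length : IsControl (fun s t => t - s) a b :=
  of_monotoneOn (g := fun x => x) (fun _ _ _ _ h => h) continuousOn_id

/-- A path whose decrements are dominated by a power larger than one of a control is
nondecreasing. -/
lemma monotoneOn_of_le_rpow (h : IsControl ϖ a b) {g : ℝ → ℝ} {C α η : ℝ} (hα : 1 < α)
    (hη : 0 < η) (hC : 0 ≤ C)
    (hg : ∀ s t, a ≤ s → s ≤ t → t ≤ b → t - s ≤ η → g s - g t ≤ C * ϖ s t ^ α) :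
    MonotoneOn g (Icc a b) := by
  intro s hs t ht hst
  have key : ∀ ε : ℝ, 0 < ε → g s - g t ≤ ε := by
    intro ε hε
    have hW := h.nonneg s t hs.1 hst ht.2
    set W := ϖ s t
    obtain ⟨κ, hκ, hκ'⟩ : ∃ κ : ℝ, 0 < κ ∧ C * κ ^ (α - 1) * W ≤ ε := by
      have : Tendsto (fun κ : ℝ => C * κ ^ (α - 1) * W) (𝓝[>] 0) (𝓝 (C * 0 ^ (α - 1) * W)) := by
        apply Tendsto.mono_left _ nhdsWithin_le_nhds
        exact ((Real.continuousAt_rpow_const 0 (α - 1) (Or.inr (by linarith))).tendsto.const_mul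
          C).mul_const W
      rw [Real.zero_rpow (by linarith)] at this
      have h2 := (this.eventually (gt_mem_nhds (show C * 0 * W < ε by simpa using hε))).and
        self_mem_nhdsWithin
      obtain ⟨κ, h3, h4⟩ := h2.exists
      exact ⟨κ, h4, h3.le⟩
    obtain ⟨η', hη', hr⟩ := h.regular κ hκ
    obtain ⟨δ, hδ, hδ1, hδ2⟩ : ∃ δ : ℝ, 0 < δ ∧ δ ≤ η ∧ δ ≤ η' :=
      ⟨min η η', by positivity, min_le_left _ _, min_le_right _ _⟩
    have step : ∀ n : ℕ, ∀ v, s ≤ v → v ≤ t → v - s ≤ n * δ →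
        g s - g v ≤ C * κ ^ (α - 1) * ϖ s v := by
      intro n
      induction n with
      | zero =>
        intro v h1 h2 h3
        obtain rfl : v = s := by
          norm_num at h3; linarith
        simp [h.self hs.1 hs.2]
      | succ n ih =>
        intro v h1 h2 h3
        push_cast at h3
        set v' := max s (v - δ)
        have hv1 : s ≤ v' := le_max_left _ _
        have hv2 : v' ≤ v := max_le h1 (by linarith)
        have hv3 : v - v' ≤ δ := by linarith [le_max_right s (v - δ)]
        have hv4 : v' - s ≤ n * δ := by
          have : v' ≤ s + n * δ := max_le (by nlinarith [Nat.cast_nonneg (α := ℝ) n]) (by linarith)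
          linarith
        have i1 := ih v' hv1 (by linarith) hv4
        have hav : a ≤ v' := hs.1.trans hv1
        have hvb : v ≤ b := h2.trans ht.2
        have i2 := hg v' v hav hv2 hvb (hv3.trans hδ1)
        have i3 := hr v' v hav hv2 hvb (hv3.trans hδ2)
        have i4 := h.nonneg v' v hav hv2 hvb
        have i5 : ϖ v' v ^ α ≤ κ ^ (α - 1) * ϖ v' v := by
          rcases i4.eq_or_lt with h0 | h0
          · rw [← h0, Real.zero_rpow (by linarith)]; simp
          · calc ϖ v' v ^ α = ϖ v' v ^ (α - 1) * ϖ v' v := by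
                  rw [← Real.rpow_add_one h0.ne']; ring_nf
              _ ≤ _ := by gcongr
        have i6 := h.add_le s v' v hs.1 hv1 hv2 hvb
        have i7 : 0 ≤ C * κ ^ (α - 1) := by positivity
        have i8 := mul_le_mul_of_nonneg_left i6 i7
        have i9 := mul_le_mul_of_nonneg_left i5 hC
        linarith
    obtain ⟨n, hn⟩ := exists_nat_ge ((t - s) / δ)
    have := step n t hst le_rfl (by rwa [div_le_iff₀ hδ] at hn)
    exact this.trans hκ'
  exact sub_nonpos.1 (le_of_forall_pos_le_add fun ε hε => by simpa using key ε hε)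

end IsControl

/-- A continuous function which is nondecreasing on each member of a countable cover by closed
intervals is nondecreasing. -/
lemma monotoneOn_of_cover {ι : Type*} [Countable ι] {g : ℝ → ℝ} {a b : ℝ} (c d : ι → ℝ)
    (hg : ContinuousOn g (Icc a b)) (hcov : Icc a b ⊆ ⋃ k, Icc (c k) (d k))
    (hm : ∀ k, MonotoneOn g (Icc (c k) (d k) ∩ Icc a b)) : MonotoneOn g (Icc a b) := by
  intro s hs t ht hst
  by_contra! hlt
  have hcount : (range (fun k => g (c k)) ∪ range fun k => g (d k)).Countable :=
    (countable_range _).union (countable_range _)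
  have hnot : ¬ (Ioo (g t) (g s) ⊆ range (fun k => g (c k)) ∪ range fun k => g (d k)) := by
    intro hsub
    have h1 := hcount.mono hsub
    have h2 := Cardinal.le_aleph0_iff_set_countable.2 h1
    rw [Cardinal.mk_Ioo_real hlt] at h2
    exact absurd h2 (not_le.2 Cardinal.aleph0_lt_continuum)
  obtain ⟨l, hl, hl'⟩ := not_subset.1 hnot
  have hsub : Icc s t ⊆ Icc a b := Icc_subset_Icc hs.1 ht.2
  have hgc := hg.mono hsub
  set S := Icc s t ∩ g ⁻¹' Ici l
  have hScl : IsCompact S :=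
    isCompact_Icc.of_isClosed_subset (hgc.preimage_isClosed_of_isClosed isClosed_Icc isClosed_Ici)
      inter_subset_left
  have hSne : S.Nonempty := ⟨s, left_mem_Icc.2 hst, hl.2.le⟩
  obtain ⟨u, huS, hmax⟩ := hScl.exists_isGreatest hSne
  have hut : u < t := by
    refine lt_of_le_of_ne huS.1.2 ?_
    rintro rfl
    exact absurd huS.2 (not_le.2 hl.1)
  have hright : ∀ v ∈ Ioc u t, g v < l := by
    intro v hv
    by_contra! hv'
    exact absurd (hmax ⟨⟨huS.1.1.trans hv.1.le, hv.2⟩, hv'⟩) (not_le.2 hv.1)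
  have hul : g u = l := by
    refine le_antisymm ?_ huS.2
    have h1 : ContinuousWithinAt g (Ioc u t) u :=
      (hgc u huS.1).mono (fun v hv => ⟨huS.1.1.trans hv.1.le, hv.2⟩)
    have : (𝓝[Ioc u t] u).NeBot := by
      rw [nhdsWithin_Ioc_eq_nhdsGT hut]; infer_instance
    exact le_of_tendsto h1 (eventually_mem_nhdsWithin.mono fun v hv => (hright v hv).le)
  obtain ⟨k, hk⟩ := mem_iUnion.1 (hcov (hsub huS.1))
  have hud : u < d k := by
    refine lt_of_le_of_ne hk.2 ?_
    rintro rfl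
    exact hl' (Or.inr ⟨k, hul⟩)
  set v := min (d k) t
  have hv : v ∈ Ioc u t := ⟨lt_min hud hut, min_le_right _ _⟩
  have := hm k ⟨hk, hsub huS.1⟩ (b := v)
    ⟨⟨hk.1.trans hv.1.le, min_le_left _ _⟩, hsub ⟨huS.1.1.trans hv.1.le, hv.2⟩⟩ hv.1.le
  have := hright v hv
  linarith

section VarControl

variable {E : Type*} [NormedAddCommGroup E] {q : ℝ} {g : ℝ → ℝ → E} {a b : ℝ}

lemma enorm_rpow_le_varControl {s t : ℝ} (hst : s ≤ t) :
    ‖g s t‖ₑ ^ q ≤ varControl q g s t := by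
  let u : ℕ → ℝ := fun i => if i = 0 then s else t
  have hu : Monotone u ∧ ∀ i, u i ∈ Icc s t := by
    constructor
    · intro i j hij
      simp only [u]
      split_ifs with h1 h2 <;> first | exact le_rfl | exact hst | (exfalso; omega)
    · intro i
      simp only [u]
      split_ifs <;> simp [hst]
  have := le_iSup (fun P : ℕ × {u : ℕ → ℝ // Monotone u ∧ ∀ i, u i ∈ Icc s t} =>
    ∑ i ∈ Finset.range P.1, ‖g (P.2.1 i) (P.2.1 (i + 1))‖ₑ ^ q) (1, ⟨u, hu⟩)
  simpa [u, varControl] using this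

lemma varControl_mono {s s' t t' : ℝ} (h1 : s' ≤ s) (h2 : t ≤ t') :
    varControl q g s t ≤ varControl q g s' t' := by
  refine iSup_le fun P => ?_
  exact le_iSup (fun P : ℕ × {u : ℕ → ℝ // Monotone u ∧ ∀ i, u i ∈ Icc s' t'} =>
    ∑ i ∈ Finset.range P.1, ‖g (P.2.1 i) (P.2.1 (i + 1))‖ₑ ^ q)
    (P.1, ⟨P.2.1, P.2.2.1, fun i => Icc_subset_Icc h1 h2 (P.2.2.2 i)⟩)

lemma varControl_add_le {s u t : ℝ} (h1 : s ≤ u) (h2 : u ≤ t) :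
    varControl q g s u + varControl q g u t ≤ varControl q g s t := by
  have : Nonempty (ℕ × {v : ℕ → ℝ // Monotone v ∧ ∀ i, v i ∈ Icc s u}) :=
    ⟨(0, ⟨fun _ => s, monotone_const, fun _ => left_mem_Icc.2 h1⟩)⟩
  have : Nonempty (ℕ × {v : ℕ → ℝ // Monotone v ∧ ∀ i, v i ∈ Icc u t}) :=
    ⟨(0, ⟨fun _ => u, monotone_const, fun _ => left_mem_Icc.2 h2⟩)⟩
  refine ENNReal.iSup_add_iSup_le fun P Q => ?_
  obtain ⟨n, v, hv, hv'⟩ := P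
  obtain ⟨k, w, hw, hw'⟩ := Q
  dsimp only
  let z : ℕ → ℝ := fun i => if i ≤ n then v i else w (i - (n + 1))
  have hz : Monotone z ∧ ∀ i, z i ∈ Icc s t := by
    constructor
    · intro i j hij
      simp only [z]
      split_ifs with c1 c2
      · exact hv hij
      · exact (hv' _).2.trans (hw' _).1
      · omega
      · exact hw (by omega)
    · intro i
      simp only [z]
      split_ifs
      · exact ⟨(hv' _).1, (hv' _).2.trans h2⟩
      · exact ⟨h1.trans (hw' _).1, (hw' _).2⟩
  have key := le_iSup (fun P : ℕ × {u : ℕ → ℝ // Monotone u ∧ ∀ i, u i ∈ Icc s t} =>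
    ∑ i ∈ Finset.range P.1, ‖g (P.2.1 i) (P.2.1 (i + 1))‖ₑ ^ q) (n + 1 + k, ⟨z, hz⟩)
  refine le_trans ?_ key
  dsimp only
  rw [Finset.sum_range_add, Finset.sum_range_succ]
  refine add_le_add (le_trans (le_of_eq ?_) le_self_add) (le_of_eq ?_)
  · refine Finset.sum_congr rfl fun i hi => ?_
    have := Finset.mem_range.1 hi
    simp only [z]
    rw [if_pos (by omega), if_pos (by omega)]
  · refine Finset.sum_congr rfl fun i hi => ?_
    simp only [z]
    rw [if_neg (by omega), if_neg (by omega)]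
    congr 4 <;> omega

lemma MemV₂.varControl_lt_top (hq : 0 < q) (h : MemV₂ q g a b) : varControl q g a b < ⊤ := by
  have := h.finite
  rw [varNorm] at this
  by_contra h'
  rw [not_lt, top_le_iff] at h'
  rw [h', ENNReal.top_rpow_of_pos (by positivity)] at this
  exact lt_irrefl _ this

/-- The variation of a two-index map of finite variation is a control. -/
lemma MemV₂.isControl (hq : 0 < q) (h : MemV₂ q g a b) :
    IsControl (fun s t => (varControl q g s t).toReal) a b where
  nonneg _ _ _ _ _ := ENNReal.toReal_nonneg
  add_le s u t x y z w := by
    have htop : ∀ s t, a ≤ s → t ≤ b → varControl q g s t ≠ ⊤ := fun s t h1 h2 =>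
      ((varControl_mono h1 h2).trans_lt (h.varControl_lt_top hq)).ne
    rw [← ENNReal.toReal_add (htop _ _ x (z.trans w)) (htop _ _ (x.trans y) w)]
    exact ENNReal.toReal_mono (htop _ _ x w) (varControl_add_le y z)
  regular ε hε := by
    obtain ⟨η, h1, h2⟩ := h.regular (ENNReal.ofReal ε) (by simpa using hε)
    refine ⟨η / 2, by positivity, fun s t x y z w => ?_⟩
    have := h2 s ⟨x, y.trans z⟩ t ⟨x.trans y, z⟩ y (by linarith)
    exact ENNReal.toReal_le_of_le_ofReal hε.le this.le

lemma MemV₂.norm_le (hq : 0 < q) (h : MemV₂ q g a b) {s t : ℝ} (h1 : a ≤ s) (h2 : s ≤ t)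
    (h3 : t ≤ b) : ‖g s t‖ ≤ (varControl q g s t).toReal ^ (1 / q) := by
  have htop : varControl q g s t ≠ ⊤ :=
    ((varControl_mono h1 h3).trans_lt (h.varControl_lt_top hq)).ne
  have h4 := ENNReal.toReal_mono htop (enorm_rpow_le_varControl (q := q) (g := g) h2)
  rw [← ENNReal.toReal_rpow, toReal_enorm] at h4
  have h5 := Real.rpow_le_rpow (by positivity) h4 (show 0 ≤ 1 / q by positivity)
  rwa [← Real.rpow_mul (norm_nonneg _), mul_one_div_cancel hq.ne', Real.rpow_one] at h5

lemma MemV₂.of_control {ϖ : ℝ → ℝ → ℝ} (hq : 0 < q) (hab : a ≤ b) (hϖ : IsControl ϖ a b)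
    (hg : ∀ s t, a ≤ s → s ≤ t → t ≤ b → ‖g s t‖ ^ q ≤ ϖ s t) : MemV₂ q g a b := by
  have key : ∀ s t, a ≤ s → s ≤ t → t ≤ b → varControl q g s t ≤ ENNReal.ofReal (ϖ s t) := by
    intro s t h1 h2 h3
    refine iSup_le fun P => ?_
    obtain ⟨n, u, hu, hu'⟩ := P
    dsimp only
    have hstep : ∀ n : ℕ, ∑ i ∈ Finset.range n, ‖g (u i) (u (i + 1))‖ₑ ^ q
        ≤ ENNReal.ofReal (ϖ (u 0) (u n)) := by
      intro n
      induction n with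
      | zero => simp
      | succ n ih =>
        rw [Finset.sum_range_succ]
        have c1 := h1.trans (hu' 0).1
        have c2 := hu (Nat.zero_le n)
        have c3 := hu (Nat.le_succ n)
        have c4 := (hu' (n + 1)).2.trans h3
        have e := hϖ.add_le (u 0) (u n) (u (n + 1)) c1 c2 c3 c4
        refine le_trans (add_le_add ih ?_) (le_trans (le_of_eq (ENNReal.ofReal_add
          (hϖ.nonneg _ _ c1 c2 (c3.trans c4))
          (hϖ.nonneg _ _ (c1.trans c2) c3 c4)).symm) (ENNReal.ofReal_le_ofReal e))
        rw [← ofReal_norm, ENNReal.ofReal_rpow_of_nonneg (norm_nonneg _) hq.le]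
        exact ENNReal.ofReal_le_ofReal (hg _ _ (c1.trans c2) c3 c4)
    refine (hstep n).trans (ENNReal.ofReal_le_ofReal ?_)
    exact hϖ.mono h1 (hu' 0).1 (hu (Nat.zero_le n)) (hu' n).2 h3
  refine ⟨?_, ?_⟩
  · rw [varNorm]
    exact ENNReal.rpow_lt_top_of_nonneg (by positivity)
      ((key a b le_rfl hab le_rfl).trans_lt ENNReal.ofReal_lt_top).ne
  · intro ε hε
    obtain ⟨ε', h1, h2⟩ := ENNReal.lt_iff_exists_real_btwn.1 hε
    have h3 : 0 < ε' := by simpa using h2.1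
    obtain ⟨η, h4, h5⟩ := hϖ.regular ε' h3
    refine ⟨η, h4, fun s hs t ht hst hlt => ?_⟩
    exact ((key s t hs.1 hst ht.2).trans
      (ENNReal.ofReal_le_ofReal (h5 s t hs.1 hst ht.2 hlt.le))).trans_lt h2.2

/-- It suffices to dominate a bounded two-index map by a control locally. -/
lemma MemV₂.of_local_control {ϖ : ℝ → ℝ → ℝ} {η M : ℝ} (hq : 0 < q) (hab : a ≤ b)
    (hϖ : IsControl ϖ a b) (hη : 0 < η)
    (hM : ∀ s t, a ≤ s → s ≤ t → t ≤ b → ‖g s t‖ ≤ M)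
    (hg : ∀ s t, a ≤ s → s ≤ t → t ≤ b → t - s ≤ η → ‖g s t‖ ^ q ≤ ϖ s t) : MemV₂ q g a b := by
  have hM0 : 0 ≤ M := (norm_nonneg _).trans (hM a a le_rfl le_rfl hab)
  refine MemV₂.of_control hq hab (hϖ.add (IsControl.length.const_mul (C := M ^ q / η)
    (by positivity))) fun s t h1 h2 h3 => ?_
  have h4 : 0 ≤ M ^ q / η * (t - s) := mul_nonneg (by positivity) (by linarith)
  rcases le_total (t - s) η with h | h
  · linarith [hg s t h1 h2 h3 h]
  · have h5 := hϖ.nonneg s t h1 h2 h3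
    have h6 : ‖g s t‖ ^ q ≤ M ^ q := Real.rpow_le_rpow (norm_nonneg _) (hM s t h1 h2 h3) hq.le
    have h7 : M ^ q ≤ M ^ q / η * (t - s) := by
      rw [div_mul_eq_mul_div, le_div_iff₀ hη]
      gcongr
    linarith

end VarControl

lemma continuousOn_of_modulus {g : ℝ → ℝ} {a b : ℝ} (h : ∀ ε : ℝ, 0 < ε → ∃ η : ℝ, 0 < η ∧
    ∀ s t, a ≤ s → s ≤ t → t ≤ b → t - s ≤ η → |g t - g s| ≤ ε) : ContinuousOn g (Icc a b) := by
  refine UniformContinuousOn.continuousOn (Metric.uniformContinuousOn_iff.2 fun ε hε => ?_)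
  obtain ⟨η, h1, h2⟩ := h (ε / 2) (by positivity)
  refine ⟨η, h1, fun x hx y hy hxy => ?_⟩
  rw [Real.dist_eq] at hxy ⊢
  rcases le_total x y with h | h
  · rw [abs_sub_comm] at hxy ⊢
    have := h2 x y hx.1 h hy.2 ((le_abs_self _).trans hxy.le)
    linarith
  · have := h2 y x hy.1 h hx.2 ((le_abs_self _).trans hxy.le)
    linarith

lemma MemV₁.continuousOn {q : ℝ} (hq : 0 < q) {g : ℝ → ℝ} {a b : ℝ} (h : MemV₁ q g a b) :
    ContinuousOn g (Icc a b) := by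
  refine continuousOn_of_modulus fun ε hε => ?_
  obtain ⟨η, h1, h2⟩ := (MemV₂.isControl hq h).regular (ε ^ q) (by positivity)
  refine ⟨η, h1, fun s t x y z w => ?_⟩
  have h3 := MemV₂.norm_le hq h x y z
  have h4 := Real.rpow_le_rpow ENNReal.toReal_nonneg (h2 s t x y z w)
    (show 0 ≤ 1 / q by positivity)
  rw [← Real.rpow_mul hε.le, mul_one_div_cancel hq.ne', Real.rpow_one] at h4
  exact h3.trans h4

/-! ### Sewing of approximate flows -/

/-- Any family of maps generates a flow along a finite set of times. -/
lemma exists_discrete_flow (μ : ℝ → ℝ → ℝ → ℝ) (F : Finset ℝ) :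
    ∃ Φ : ℝ → ℝ → ℝ → ℝ, (∀ s x, Φ s s x = x) ∧
      (∀ s ∈ F, ∀ u ∈ F, ∀ t ∈ F, s ≤ u → u ≤ t → ∀ x, Φ u t (Φ s u x) = Φ s t x) ∧
      ∀ s ∈ F, ∀ t ∈ F, s < t → (∀ v ∈ F, ¬(s < v ∧ v < t)) → ∀ x, Φ s t x = μ s t x := by
  induction F using Finset.induction_on_max with
  | empty => exact ⟨fun _ _ x => x, by simp⟩
  | insert a F hlt ih =>
    obtain ⟨Φ, h1, h2, h3⟩ := ih
    rcases F.eq_empty_or_nonempty with rfl | hne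
    · refine ⟨Φ, h1, ?_, ?_⟩
      · intro s hs u hu t ht _ _ x
        simp only [insert_empty_eq, Finset.mem_singleton] at hs hu ht
        subst hs hu ht
        rw [h1, h1]
      · intro s hs t ht hst
        simp only [insert_empty_eq, Finset.mem_singleton] at hs ht
        exact absurd hst (by rw [hs, ht]; exact lt_irrefl _)
    · set m := F.max' hne
      have hm : m ∈ F := F.max'_mem hne
      have hma := hlt m hm
      have hle : ∀ s ∈ F, s ≤ m := fun s hs => F.le_max' s hs
      refine ⟨fun s t x => if t = a then (if s = a then x else μ m a (Φ s m x)) else Φ s t x,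
        ?_, ?_, ?_⟩
      · intro s x
        dsimp only
        split_ifs
        · rfl
        · exact h1 s x
      · intro s hs u hu t ht hsu hut x
        rw [Finset.mem_insert] at hs hu ht
        rcases ht with rfl | ht
        · rcases hs with rfl | hs
          · have hu' : u = s := le_antisymm hut hsu
            simp [hu']
          · have hsa := (hlt s hs).ne
            rcases hu with rfl | hu
            · simp
            · have hua := (hlt u hu).ne
              simp only [if_true, hua, hsa, if_false]
              rw [h2 s hs u hu m hm hsu (hle u hu)]
        · have hta := hlt t ht
          have hu : u ∈ F := hu.resolve_left (by rintro rfl; linarith)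
          have hs : s ∈ F := hs.resolve_left (by rintro rfl; linarith)
          simp only [hta.ne, (hlt u hu).ne, if_false]
          exact h2 s hs u hu t ht hsu hut x
      · intro s hs t ht hst hcon x
        rw [Finset.mem_insert] at hs ht
        rcases ht with rfl | ht
        · have hs : s ∈ F := hs.resolve_left (by rintro rfl; linarith)
          have hsm : s = m := by
            by_contra hne'
            exact hcon m (Finset.mem_insert_of_mem hm)
              ⟨lt_of_le_of_ne (hle s hs) hne', hma⟩
          simp only [if_true, hst.ne, if_false]
          rw [hsm, h1]
        · have hta := hlt t ht
          have hs : s ∈ F := hs.resolve_left (by rintro rfl; linarith)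
          simp only [hta.ne, if_false]
          exact h3 s hs t ht hst (fun v hv => hcon v (Finset.mem_insert_of_mem hv)) x

/-- The discrete sewing lemma: an almost superadditive function of pairs of points of a finite set
which vanishes at consecutive points is small. -/
lemma discrete_sewing {ϖ : ℝ → ℝ → ℝ} {a b : ℝ} (hϖ : IsControl ϖ a b) (F : Finset ℝ)
    (hF : ∀ v ∈ F, v ∈ Icc a b) (r : ℝ → ℝ → ℝ) {α c K Q : ℝ} (hα : 0 < α) (hc : 0 ≤ c)
    (hK : 0 ≤ K) (hQ : 0 ≤ Q) (hcQ : (c + c ^ 2) / 2 ^ α * Q + (1 + c) ≤ Q)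
    (h1 : ∀ s ∈ F, ∀ u ∈ F, ∀ t ∈ F, s ≤ u → u ≤ t → r s t ≤ c * (r s u + r u t) + K * ϖ s t ^ α)
    (h2 : ∀ s ∈ F, ∀ t ∈ F, s ≤ t → (∀ v ∈ F, ¬(s < v ∧ v < t)) → r s t ≤ 0) :
    ∀ s ∈ F, ∀ t ∈ F, s ≤ t → r s t ≤ Q * K * ϖ s t ^ α := by
  have main : ∀ n : ℕ, ∀ s ∈ F, ∀ t ∈ F, s ≤ t → (F.filter fun v => s < v ∧ v < t).card ≤ n →
      r s t ≤ Q * K * ϖ s t ^ α := by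
    intro n
    induction n with
    | zero =>
      intro s hs t ht hst hcard
      have h0 := hϖ.nonneg s t (hF s hs).1 hst (hF t ht).2
      refine (h2 s hs t ht hst fun v hv hv' => ?_).trans (by positivity)
      have : v ∈ F.filter fun v => s < v ∧ v < t := Finset.mem_filter.2 ⟨hv, hv'⟩
      simp only [nonpos_iff_eq_zero, Finset.card_eq_zero] at hcard
      simp [hcard] at this
    | succ n ih =>
      intro s hs t ht hst hcard
      have h0 := hϖ.nonneg s t (hF s hs).1 hst (hF t ht).2
      rcases hst.eq_or_lt with rfl | hlt
      · exact (h2 s hs s hs le_rfl fun v hv hv' => by linarith).trans (by positivity)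
      set W := ϖ s t
      have hself := hϖ.self (hF s hs).1 (hF s hs).2
      have hne : (F.filter fun v => s ≤ v ∧ v < t ∧ ϖ s v ≤ W / 2).Nonempty :=
        ⟨s, Finset.mem_filter.2 ⟨hs, le_rfl, hlt, by rw [hself]; positivity⟩⟩
      obtain ⟨v, hv, hvmax⟩ := Finset.exists_max_image _ id hne
      obtain ⟨hvF, hsv, hvt, hvW⟩ := Finset.mem_filter.1 hv
      have hne' : (F.filter fun w => v < w ∧ w ≤ t).Nonempty :=
        ⟨t, Finset.mem_filter.2 ⟨ht, hvt, le_rfl⟩⟩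
      obtain ⟨w, hw, hwmin⟩ := Finset.exists_min_image _ id hne'
      obtain ⟨hwF, hvw, hwt⟩ := Finset.mem_filter.1 hw
      simp only [id] at hvmax hwmin
      have hcon : r v w ≤ 0 := by
        refine h2 v hvF w hwF hvw.le fun z hz hz' => ?_
        have := hwmin z (Finset.mem_filter.2 ⟨hz, hz'.1, hz'.2.le.trans hwt⟩)
        linarith
      have hbound : ∀ x ∈ F, ∀ y ∈ F, s ≤ x → x ≤ y → y ≤ t → (s < x ∨ y < t) → ϖ x y ≤ W / 2 →
          r x y ≤ Q * K * (W / 2) ^ α := by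
        intro x hx y hy hsx hxy hyt hor hle
        have h0' := hϖ.nonneg x y (hF x hx).1 hxy (hF y hy).2
        have hmono : Q * K * ϖ x y ^ α ≤ Q * K * (W / 2) ^ α := by gcongr
        refine le_trans ?_ hmono
        rcases hxy.eq_or_lt with rfl | hxy'
        · exact (h2 x hx x hx le_rfl fun v hv hv' => by linarith).trans (by positivity)
        refine ih x hx y hy hxy ?_
        have : (F.filter fun v => x < v ∧ v < y).card < (F.filter fun v => s < v ∧ v < t).card := by
          refine Finset.card_lt_card ⟨?_, ?_⟩
          · intro z hz
            obtain ⟨hz1, hz2, hz3⟩ := Finset.mem_filter.1 hz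
            exact Finset.mem_filter.2 ⟨hz1, hsx.trans_lt hz2, hz3.trans_le hyt⟩
          · intro hsub
            rcases hor with h | h
            · have := hsub (Finset.mem_filter.2 ⟨hx, h, hxy'.trans_le hyt⟩)
              exact lt_irrefl _ (Finset.mem_filter.1 this).2.1
            · have := hsub (Finset.mem_filter.2 ⟨hy, hsx.trans_lt hxy', h⟩)
              exact lt_irrefl _ (Finset.mem_filter.1 this).2.2
        omega
      have e1 : r s v ≤ Q * K * (W / 2) ^ α :=
        hbound s hs v hvF le_rfl hsv hvt.le (Or.inr hvt) hvW
      have e2 : r w t ≤ Q * K * (W / 2) ^ α := by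
        refine hbound w hwF t ht (hsv.trans hvw.le) hwt le_rfl (Or.inl (hsv.trans_lt hvw)) ?_
        rcases hwt.eq_or_lt with h | h
        · rw [h, hϖ.self (hF t ht).1 (hF t ht).2]; positivity
        · have h3 : W / 2 < ϖ s w := by
            by_contra! h4
            have := hvmax w (Finset.mem_filter.2 ⟨hwF, hsv.trans hvw.le, h, h4⟩)
            linarith
          have := hϖ.add_le s w t (hF s hs).1 (hsv.trans hvw.le) hwt (hF t ht).2
          linarith
      have e3 := h1 s hs v hvF t ht hsv hvt.le
      have e4 := h1 v hvF w hwF t ht hvw.le hwt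
      have hmv : ϖ v t ≤ W := hϖ.mono (hF s hs).1 hsv hvt.le le_rfl (hF t ht).2
      have h0v := hϖ.nonneg v t (hF v hvF).1 hvt.le (hF t ht).2
      have e5 : K * ϖ v t ^ α ≤ K * W ^ α := by gcongr
      have e6 : r v t ≤ c * (Q * K * (W / 2) ^ α) + K * W ^ α := by
        have := mul_le_mul_of_nonneg_left (show r v w + r w t ≤ Q * K * (W / 2) ^ α by linarith) hc
        linarith
      have e7 : r s t ≤ c * (Q * K * (W / 2) ^ α + (c * (Q * K * (W / 2) ^ α) + K * W ^ α))
          + K * W ^ α := by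
        have := mul_le_mul_of_nonneg_left (add_le_add e1 e6) hc
        linarith
      have e8 : (W / 2) ^ α = W ^ α / 2 ^ α := Real.div_rpow h0 (by norm_num) _
      have e9 := mul_le_mul_of_nonneg_right hcQ (show 0 ≤ K * W ^ α by positivity)
      refine e7.trans (le_trans (le_of_eq ?_) (e9.trans (le_of_eq (by ring))))
      rw [e8]
      ring
  exact fun s hs t ht hst => main _ s hs t ht hst le_rfl

lemma exists_sewing_constants {α : ℝ} (hα : 1 < α) :
    ∃ c Q : ℝ, 1 < c ∧ c ≤ 2 ∧ 0 ≤ Q ∧ (c + c ^ 2) / 2 ^ α * Q + (1 + c) ≤ Q := by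
  have h2 : (2 : ℝ) < 2 ^ α := by
    simpa using Real.rpow_lt_rpow_of_exponent_lt (x := 2) (by norm_num) hα
  obtain ⟨x, hx0, hx1, hx2⟩ : ∃ x : ℝ, 0 < x ∧ x ≤ 1 ∧ 8 * x ≤ 2 ^ α - 2 :=
    ⟨min 1 ((2 ^ α - 2) / 8), lt_min one_pos (by linarith), min_le_left _ _, by
      linarith [min_le_right 1 (((2 : ℝ) ^ α - 2) / 8)]⟩
  have hlt : (1 + x) + (1 + x) ^ 2 < (2 : ℝ) ^ α := by nlinarith
  have hq : ((1 + x) + (1 + x) ^ 2) / (2 : ℝ) ^ α < 1 := by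
    rwa [div_lt_one (by positivity)]
  set q := ((1 + x) + (1 + x) ^ 2) / (2 : ℝ) ^ α
  have hq' : 0 < 1 - q := by linarith
  refine ⟨1 + x, (1 + (1 + x)) / (1 - q), by linarith, by linarith, by positivity, le_of_eq ?_⟩
  change q * _ + _ = _
  field_simp
  ring

/-- Approximate flows: maps which are close to the identity and have a small flow defect, in the
Lipschitz sense. -/
structure IsApproxFlow (μ : ℝ → ℝ → ℝ → ℝ) (ϖ : ℝ → ℝ → ℝ) (a b η α β Λ K : ℝ) : Prop where
  self : ∀ s x, a ≤ s → s ≤ b → μ s s x = x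
  disp : ∀ s t, a ≤ s → s ≤ t → t ≤ b → t - s ≤ η → ∀ x, |μ s t x - x| ≤ Λ * ϖ s t ^ β
  lip : ∀ s t, a ≤ s → s ≤ t → t ≤ b → t - s ≤ η → ∀ x y,
    |(μ s t x - x) - (μ s t y - y)| ≤ Λ * ϖ s t ^ β * |x - y|
  four : ∀ s t, a ≤ s → s ≤ t → t ≤ b → t - s ≤ η → ∀ x x' y y',
    |(μ s t x - x) - (μ s t x' - x') - ((μ s t y - y) - (μ s t y' - y'))| ≤
      Λ * ϖ s t ^ β * (|x - x' - (y - y')| + |x - x'| * (|x - y| + |x' - y'|))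
  defect : ∀ s u t, a ≤ s → s ≤ u → u ≤ t → t ≤ b → t - s ≤ η → ∀ x,
    |μ u t (μ s u x) - μ s t x| ≤ K * ϖ s t ^ α
  defect_lip : ∀ s u t, a ≤ s → s ≤ u → u ≤ t → t ≤ b → t - s ≤ η → ∀ x y,
    |(μ u t (μ s u x) - μ s t x) - (μ u t (μ s u y) - μ s t y)| ≤ K * ϖ s t ^ α * |x - y|

/-- Flows of increasing bi-Lipschitz maps which are close to a given approximate flow. -/
structure IsFlowOf (Φ μ : ℝ → ℝ → ℝ → ℝ) (ϖ : ℝ → ℝ → ℝ) (a b η α β B C : ℝ) : Prop where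
  self : ∀ s x, a ≤ s → s ≤ b → Φ s s x = x
  comp : ∀ s u t, a ≤ s → s ≤ u → u ≤ t → t ≤ b → ∀ x, Φ u t (Φ s u x) = Φ s t x
  upper : ∀ s t, a ≤ s → s ≤ t → t ≤ b → ∀ x y, x ≤ y → Φ s t y - Φ s t x ≤ B * (y - x)
  lower : ∀ s t, a ≤ s → s ≤ t → t ≤ b → ∀ x y, x ≤ y → y - x ≤ B * (Φ s t y - Φ s t x)
  disp : ∀ s t, a ≤ s → s ≤ t → t ≤ b → ∀ x, |Φ s t x - x| ≤ B
  close : ∀ s t, a ≤ s → s ≤ t → t ≤ b → t - s ≤ η → ∀ x,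
    |Φ s t x - μ s t x| ≤ C * ϖ s t ^ α
  disp_le : ∀ s t, a ≤ s → s ≤ t → t ≤ b → t - s ≤ η → ∀ x,
    |Φ s t x - x| ≤ C * (ϖ s t ^ β + ϖ s t ^ α)
  lip : ∀ s t, a ≤ s → s ≤ t → t ≤ b → t - s ≤ η → ∀ x y,
    |(Φ s t x - x) - (Φ s t y - y)| ≤ C * (ϖ s t ^ β + ϖ s t ^ α) * |x - y|

section Discrete

variable {μ : ℝ → ℝ → ℝ → ℝ} {ϖ : ℝ → ℝ → ℝ} {a b η α β Λ K c Q : ℝ}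

/-- Estimate of the discrete trajectories of an approximate flow. -/
lemma IsApproxFlow.trajectory (hμ : IsApproxFlow μ ϖ a b η α β Λ K) (hϖ : IsControl ϖ a b)
    (hα : 1 < α) (hβ : 0 < β) (hΛ : 0 ≤ Λ) (hK : 0 ≤ K) (hc : 1 < c) (hQ : 0 ≤ Q)
    (hcQ : (c + c ^ 2) / 2 ^ α * Q + (1 + c) ≤ Q) {s₀ t₀ : ℝ} (h₁ : a ≤ s₀)
    (h₃ : t₀ ≤ b) (h₄ : t₀ - s₀ ≤ η) (h₅ : Λ * ϖ s₀ t₀ ^ β ≤ c - 1) {F : Finset ℝ}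
    (hF : ∀ v ∈ F, v ∈ Icc s₀ t₀) {y : ℝ → ℝ}
    (hy : ∀ s ∈ F, ∀ t ∈ F, s < t → (∀ v ∈ F, ¬(s < v ∧ v < t)) → y t = μ s t (y s)) :
    ∀ s ∈ F, ∀ t ∈ F, s ≤ t → |y t - μ s t (y s)| ≤ Q * K * ϖ s t ^ α := by
  refine discrete_sewing (hϖ.restrict h₁ h₃) F hF (fun s t => |y t - μ s t (y s)|) (by linarith)
    (by linarith) hK hQ hcQ ?_ ?_
  · intro s hs u hu t ht hsu hut
    have as := h₁.trans (hF s hs).1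
    have tb := (hF t ht).2.trans h₃
    have hts : t - s ≤ η := by linarith [(hF s hs).1, (hF t ht).2]
    have i1 := hμ.defect s u t as hsu hut tb hts (y s)
    have i2 := hμ.lip u t (as.trans hsu) hut tb (by linarith) (y u) (μ s u (y s))
    have i3 : Λ * ϖ u t ^ β ≤ c - 1 := by
      refine le_trans ?_ h₅
      have := hϖ.nonneg u t (as.trans hsu) hut tb
      have := hϖ.mono h₁ (hF u hu).1 hut (hF t ht).2 h₃
      gcongr
    have i4 := mul_le_mul_of_nonneg_right i3 (abs_nonneg (y u - μ s u (y s)))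
    have i5 : |y t - μ s t (y s)| ≤ |y t - μ u t (y u)| + |μ u t (μ s u (y s)) - μ s t (y s)|
        + (|(μ u t (y u) - y u) - (μ u t (μ s u (y s)) - μ s u (y s))| + |y u - μ s u (y s)|) := by
      have e : y t - μ s t (y s) = ((y t - μ u t (y u)) + (μ u t (μ s u (y s)) - μ s t (y s)))
        + (((μ u t (y u) - y u) - (μ u t (μ s u (y s)) - μ s u (y s))) + (y u - μ s u (y s))) := by
        ring
      rw [e]
      refine (abs_add_le _ _).trans (add_le_add (abs_add_le _ _) (abs_add_le _ _))
    have i6 : |y t - μ u t (y u)| ≤ c * |y t - μ u t (y u)| :=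
      le_mul_of_one_le_left (abs_nonneg _) hc.le
    linarith
  · intro s hs t ht hst hcon
    rcases hst.eq_or_lt with rfl | hlt
    · simp [hμ.self s (y s) (h₁.trans (hF s hs).1) ((hF s hs).2.trans h₃)]
    · simp [hy s hs t ht hlt hcon]

/-- Estimate of the difference of two discrete trajectories of an approximate flow. -/
lemma IsApproxFlow.trajectory_sub (hμ : IsApproxFlow μ ϖ a b η α β Λ K) (hϖ : IsControl ϖ a b)
    (hα : 1 < α) (hβ : 0 < β) (hΛ : 0 ≤ Λ) (hK : 0 ≤ K) (hc : 1 < c) (hc' : c ≤ 2) (hQ : 0 ≤ Q)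
    (hcQ : (c + c ^ 2) / 2 ^ α * Q + (1 + c) ≤ Q) {s₀ t₀ : ℝ} (h₁ : a ≤ s₀)
    (h₃ : t₀ ≤ b) (h₄ : t₀ - s₀ ≤ η) (h₅ : Λ * ϖ s₀ t₀ ^ β ≤ c - 1)
    (h₆ : Q * (3 * (Q * K) + K) * ϖ s₀ t₀ ^ α ≤ 1 / 2) {F : Finset ℝ}
    (hF : ∀ v ∈ F, v ∈ Icc s₀ t₀) (hs₀ : s₀ ∈ F) {y z : ℝ → ℝ}
    (hy : ∀ s ∈ F, ∀ t ∈ F, s < t → (∀ v ∈ F, ¬(s < v ∧ v < t)) → y t = μ s t (y s))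
    (hz : ∀ s ∈ F, ∀ t ∈ F, s < t → (∀ v ∈ F, ¬(s < v ∧ v < t)) → z t = μ s t (z s)) :
    ∀ t ∈ F, |(y t - μ s₀ t (y s₀)) - (z t - μ s₀ t (z s₀))| ≤
      4 * (Q * (3 * (Q * K) + K)) * ϖ s₀ t ^ α * |y s₀ - z s₀| := by
  obtain ⟨τ, hτ, hmax⟩ := Finset.exists_max_image F (fun v => |y v - z v|) ⟨s₀, hs₀⟩
  set D := |y τ - z τ|
  have hD : 0 ≤ D := abs_nonneg _
  have hzt := hμ.trajectory hϖ hα hβ hΛ hK hc hQ hcQ h₁ h₃ h₄ h₅ hF hz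
  have hyt := hμ.trajectory hϖ hα hβ hΛ hK hc hQ hcQ h₁ h₃ h₄ h₅ hF hy
  have hwin : ∀ s ∈ F, ∀ t ∈ F, s ≤ t → Λ * ϖ s t ^ β ≤ c - 1 := by
    intro s hs t ht hst
    refine le_trans ?_ h₅
    have := hϖ.nonneg s t (h₁.trans (hF s hs).1) hst ((hF t ht).2.trans h₃)
    have := hϖ.mono h₁ (hF s hs).1 hst (hF t ht).2 h₃
    gcongr
  have key : ∀ s ∈ F, ∀ t ∈ F, s ≤ t →
      |(y t - μ s t (y s)) - (z t - μ s t (z s))| ≤ Q * ((3 * (Q * K) + K) * D) * ϖ s t ^ α := by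
    refine discrete_sewing (hϖ.restrict h₁ h₃) F hF
      (fun s t => |(y t - μ s t (y s)) - (z t - μ s t (z s))|) (by linarith)
      (by linarith) (by positivity) hQ hcQ ?_ ?_
    · intro s hs u hu t ht hsu hut
      have as := h₁.trans (hF s hs).1
      have tb := (hF t ht).2.trans h₃
      have hts : t - s ≤ η := by linarith [(hF s hs).1, (hF t ht).2]
      have hW := hϖ.nonneg s t as (hsu.trans hut) tb
      set ρ := |(y u - μ s u (y s)) - (z u - μ s u (z s))|
      have i1 := hμ.defect_lip s u t as hsu hut tb hts (y s) (z s)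
      have i2 := hμ.four u t (as.trans hsu) hut tb (by linarith) (y u) (μ s u (y s)) (z u)
        (μ s u (z s))
      have i3 := hwin u hu t ht hut
      have i4 : |y u - z u| ≤ D := hmax u hu
      have i4' : |y s - z s| ≤ D := hmax s hs
      have i5 : |μ s u (y s) - μ s u (z s)| ≤ 2 * D := by
        have j1 := hμ.lip s u as hsu (hut.trans tb) (by linarith) (y s) (z s)
        have j2 := mul_le_mul (hwin s hs u hu hsu) i4' (abs_nonneg _) (by linarith)
        have j3 : |μ s u (y s) - μ s u (z s)| ≤
            |(μ s u (y s) - y s) - (μ s u (z s) - z s)| + |y s - z s| := by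
          refine le_trans (le_of_eq ?_) (abs_add_le _ _)
          congr 1; ring
        nlinarith
      have i6 : |y u - μ s u (y s)| ≤ Q * K * ϖ s t ^ α := by
        refine (hyt s hs u hu hsu).trans ?_
        have := hϖ.nonneg s u as hsu (hut.trans tb)
        have := hϖ.mono as le_rfl hsu hut tb
        gcongr
      have i7 : |y u - μ s u (y s)| * (|y u - z u| + |μ s u (y s) - μ s u (z s)|) ≤
          Q * K * ϖ s t ^ α * (3 * D) :=
        mul_le_mul i6 (by linarith) (by positivity) (by positivity)
      have i8 : 0 ≤ |y u - μ s u (y s)| * (|y u - z u| + |μ s u (y s) - μ s u (z s)|) := by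
        positivity
      have i9 := mul_le_mul_of_nonneg_right i3 (add_nonneg (abs_nonneg
        (y u - μ s u (y s) - (z u - μ s u (z s)))) i8)
      have i10 : |(y t - μ s t (y s)) - (z t - μ s t (z s))| ≤
          |(y t - μ u t (y u)) - (z t - μ u t (z u))| +
          |(μ u t (μ s u (y s)) - μ s t (y s)) - (μ u t (μ s u (z s)) - μ s t (z s))|
          + (|(μ u t (y u) - y u) - (μ u t (μ s u (y s)) - μ s u (y s)) -
            ((μ u t (z u) - z u) - (μ u t (μ s u (z s)) - μ s u (z s)))| + ρ) := by
        have e : (y t - μ s t (y s)) - (z t - μ s t (z s)) =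
            (((y t - μ u t (y u)) - (z t - μ u t (z u))) +
          ((μ u t (μ s u (y s)) - μ s t (y s)) - (μ u t (μ s u (z s)) - μ s t (z s))))
          + (((μ u t (y u) - y u) - (μ u t (μ s u (y s)) - μ s u (y s)) -
            ((μ u t (z u) - z u) - (μ u t (μ s u (z s)) - μ s u (z s)))) +
              ((y u - μ s u (y s)) - (z u - μ s u (z s)))) := by
          ring
        rw [e]
        refine (abs_add_le _ _).trans (add_le_add (abs_add_le _ _) (abs_add_le _ _))
      have i11 : |(y t - μ u t (y u)) - (z t - μ u t (z u))| ≤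
          c * |(y t - μ u t (y u)) - (z t - μ u t (z u))| :=
        le_mul_of_one_le_left (abs_nonneg _) hc.le
      have i12 : K * ϖ s t ^ α * |y s - z s| ≤ K * ϖ s t ^ α * D := by gcongr
      have i13 : (c - 1) * (|y u - μ s u (y s)| * (|y u - z u| + |μ s u (y s) - μ s u (z s)|)) ≤
          |y u - μ s u (y s)| * (|y u - z u| + |μ s u (y s) - μ s u (z s)|) :=
        mul_le_of_le_one_left i8 (by linarith)
      linarith
    · intro s hs t ht hst hcon
      rcases hst.eq_or_lt with rfl | hlt
      · simp [hμ.self s _ (h₁.trans (hF s hs).1) ((hF s hs).2.trans h₃)]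
      · simp [hy s hs t ht hlt hcon, hz s hs t ht hlt hcon]
  have hDle : D ≤ 4 * |y s₀ - z s₀| := by
    have hsτ := (hF τ hτ).1
    have k1 := key s₀ hs₀ τ hτ hsτ
    have k2 := hμ.lip s₀ τ h₁ hsτ ((hF τ hτ).2.trans h₃) (by linarith [(hF τ hτ).2]) (y s₀) (z s₀)
    have k3 := mul_le_mul_of_nonneg_right (hwin s₀ hs₀ τ hτ hsτ) (abs_nonneg (y s₀ - z s₀))
    have k4 : D ≤ |(y τ - μ s₀ τ (y s₀)) - (z τ - μ s₀ τ (z s₀))| +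
        (|(μ s₀ τ (y s₀) - y s₀) - (μ s₀ τ (z s₀) - z s₀)| + |y s₀ - z s₀|) := by
      refine le_trans (le_of_eq ?_) ((abs_add_le _ _).trans
        (add_le_add le_rfl (abs_add_le _ _)))
      simp only [D]
      congr 1; ring
    have k5 : Q * ((3 * (Q * K) + K) * D) * ϖ s₀ τ ^ α ≤ 1 / 2 * D := by
      have j1 := hϖ.nonneg s₀ τ h₁ hsτ ((hF τ hτ).2.trans h₃)
      have j2 := hϖ.mono h₁ le_rfl hsτ (hF τ hτ).2 h₃
      calc Q * ((3 * (Q * K) + K) * D) * ϖ s₀ τ ^ α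
          = Q * (3 * (Q * K) + K) * ϖ s₀ τ ^ α * D := by ring
        _ ≤ Q * (3 * (Q * K) + K) * ϖ s₀ t₀ ^ α * D := by gcongr
        _ ≤ 1 / 2 * D := by gcongr
    nlinarith [abs_nonneg (y s₀ - z s₀)]
  intro t ht
  refine (key s₀ hs₀ t ht (hF t ht).1).trans ?_
  have j1 := hϖ.nonneg s₀ t h₁ (hF t ht).1 ((hF t ht).2.trans h₃)
  calc Q * ((3 * (Q * K) + K) * D) * ϖ s₀ t ^ α
      = Q * (3 * (Q * K) + K) * ϖ s₀ t ^ α * D := by ring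
    _ ≤ Q * (3 * (Q * K) + K) * ϖ s₀ t ^ α * (4 * |y s₀ - z s₀|) := by gcongr
    _ = _ := by ring

end Discrete

lemma exists_tendsto_ultrafilter {ι : Type*} (U : Ultrafilter ι) {g : ι → ℝ} {M : ℝ}
    (h : ∀ᶠ i in (U : Filter ι), |g i| ≤ M) : ∃ l, Tendsto g U (𝓝 l) := by
  have h1 : ((U.map g : Ultrafilter ℝ) : Filter ℝ) ≤ 𝓟 (Icc (-M) M) := by
    rw [le_principal_iff]
    exact h.mono fun i hi => abs_le.1 hi
  obtain ⟨l, -, hl⟩ := isCompact_Icc.ultrafilter_le_nhds' (U.map g) (le_principal_iff.1 h1)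
  exact ⟨l, hl⟩

/-- Near the diagonal, a power of a control is as small as one wishes. -/
lemma IsControl.exists_rpow_le {ϖ : ℝ → ℝ → ℝ} {a b : ℝ} (h : IsControl ϖ a b) {C β ε : ℝ}
    (hC : 0 ≤ C) (hβ : 0 < β) (hε : 0 < ε) : ∃ η : ℝ, 0 < η ∧
      ∀ s t, a ≤ s → s ≤ t → t ≤ b → t - s ≤ η → C * ϖ s t ^ β ≤ ε := by
  obtain ⟨η, h1, h2⟩ := h.regular ((ε / (C + 1)) ^ (1 / β)) (by positivity)
  refine ⟨η, h1, fun s t x y z w => ?_⟩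
  have h3 := Real.rpow_le_rpow (h.nonneg s t x y z) (h2 s t x y z w) hβ.le
  rw [← Real.rpow_mul (by positivity), one_div_mul_cancel hβ.ne', Real.rpow_one,
    le_div_iff₀ (by positivity)] at h3
  have := Real.rpow_nonneg (h.nonneg s t x y z) β
  linarith

/-- The nonlinear sewing lemma: an approximate flow is close to a flow. -/
theorem IsApproxFlow.exists_flow {μ : ℝ → ℝ → ℝ → ℝ} {ϖ : ℝ → ℝ → ℝ} {a b η α β Λ K : ℝ}
    (hμ : IsApproxFlow μ ϖ a b η α β Λ K) (hϖ : IsControl ϖ a b) (hη : 0 < η)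
    (hα : 1 < α) (hβ : 0 < β) (hΛ : 0 ≤ Λ) (hK : 0 ≤ K) :
    ∃ (Φ : ℝ → ℝ → ℝ → ℝ) (η' B C : ℝ), 0 < η' ∧ 0 < B ∧ 0 ≤ C ∧
      IsFlowOf Φ μ ϖ a b η' α β B C := by
  obtain ⟨c, Q, hc, hc', hQ, hcQ⟩ := exists_sewing_constants hα
  set C₁ := Q * K
  set C₂ := Q * (3 * (Q * K) + K)
  have hC₁ : 0 ≤ C₁ := by positivity
  have hC₂ : 0 ≤ C₂ := by positivity
  obtain ⟨η₁, hη₁, hw₁⟩ := hϖ.exists_rpow_le hΛ hβ (show 0 < c - 1 by linarith)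
  obtain ⟨η₂, hη₂, hw₂⟩ := hϖ.exists_rpow_le hC₂ (show 0 < α by linarith)
    (show (0 : ℝ) < 1 / 16 by norm_num)
  obtain ⟨η₃, hη₃, hw₃⟩ := hϖ.exists_rpow_le hC₁ (show 0 < α by linarith)
    (show (0 : ℝ) < 1 / 2 by norm_num)
  obtain ⟨η₄, hη₄, hw₄⟩ := hϖ.exists_rpow_le hΛ hβ (show (0 : ℝ) < 1 / 4 by norm_num)
  obtain ⟨h, hh, hh0, hh1, hh2, hh3, hh4⟩ : ∃ h : ℝ, 0 < h ∧ h ≤ η ∧ h ≤ η₁ ∧ h ≤ η₂ ∧ h ≤ η₃ ∧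
      h ≤ η₄ :=
    ⟨min η (min η₁ (min η₂ (min η₃ η₄))), by positivity, by simp, by simp, by simp, by simp,
      by simp⟩
  choose Ψ hΨ1 hΨ2 hΨ3 using fun F : Finset ℝ =>
    exists_discrete_flow μ (F.filter fun v => v ∈ Icc a b)
  -- estimates of the discrete flows on short intervals
  have hclose : ∀ F : Finset ℝ, ∀ s ∈ F, ∀ t ∈ F, a ≤ s → s ≤ t → t ≤ b → t - s ≤ h →
      (∀ x, |Ψ F s t x - μ s t x| ≤ C₁ * ϖ s t ^ α) ∧
      ∀ x y, |(Ψ F s t x - μ s t x) - (Ψ F s t y - μ s t y)| ≤ 4 * C₂ * ϖ s t ^ α * |x - y| := by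
    intro F s hs t ht has hst htb hts
    set G := F.filter fun v => v ∈ Icc s t
    have hG : ∀ v ∈ G, v ∈ F.filter fun v => v ∈ Icc a b := fun v hv => by
      obtain ⟨h1, h2⟩ := Finset.mem_filter.1 hv
      exact Finset.mem_filter.2 ⟨h1, has.trans h2.1, h2.2.trans htb⟩
    have hGI : ∀ v ∈ G, v ∈ Icc s t := fun v hv => (Finset.mem_filter.1 hv).2
    have hsG : s ∈ G := Finset.mem_filter.2 ⟨hs, le_rfl, hst⟩
    have htG : t ∈ G := Finset.mem_filter.2 ⟨ht, hst, le_rfl⟩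
    have htraj : ∀ x, ∀ u ∈ G, ∀ w ∈ G, u < w → (∀ v ∈ G, ¬(u < v ∧ v < w)) →
        Ψ F s w x = μ u w (Ψ F s u x) := by
      intro x u hu w hw huw hcon
      rw [← hΨ2 F s (hG s hsG) u (hG u hu) w (hG w hw) (hGI u hu).1 huw.le,
        hΨ3 F u (hG u hu) w (hG w hw) huw]
      rintro v hv ⟨h1, h2⟩
      exact hcon v (Finset.mem_filter.2 ⟨(Finset.mem_filter.1 hv).1,
        (hGI u hu).1.trans h1.le, h2.le.trans (hGI w hw).2⟩) ⟨h1, h2⟩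
    have hwin := hw₁ s t has hst htb (hts.trans hh1)
    refine ⟨fun x => ?_, fun x y => ?_⟩
    · have := hμ.trajectory hϖ hα hβ hΛ hK hc hQ hcQ has htb (hts.trans hh0) hwin hGI
        (htraj x) s hsG t htG hst
      rwa [hΨ1] at this
    · have := hμ.trajectory_sub hϖ hα hβ hΛ hK hc hc' hQ hcQ has htb (hts.trans hh0) hwin
        ((hw₂ s t has hst htb (hts.trans hh2)).trans (by norm_num)) hGI hsG (htraj x) (htraj y)
        t htG
      rwa [hΨ1, hΨ1] at this
  have hlocal : ∀ F : Finset ℝ, ∀ s ∈ F, ∀ t ∈ F, a ≤ s → s ≤ t → t ≤ b → t - s ≤ h → ∀ x,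
      |Ψ F s t x - x| ≤ 1 ∧ ∀ y, x ≤ y → Ψ F s t y - Ψ F s t x ≤ 2 * (y - x) ∧
        y - x ≤ 2 * (Ψ F s t y - Ψ F s t x) := by
    intro F s hs t ht has hst htb hts x
    obtain ⟨e1, e2⟩ := hclose F s hs t ht has hst htb hts
    refine ⟨?_, fun y hxy => ?_⟩
    · have i1 := e1 x
      have i2 := hμ.disp s t has hst htb (hts.trans hh0) x
      have i3 := hw₃ s t has hst htb (hts.trans hh3)
      have i4 := hw₄ s t has hst htb (hts.trans hh4)
      have i5 := abs_sub_le (Ψ F s t x) (μ s t x) x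
      linarith
    · have i1 := e2 y x
      have i2 := hμ.lip s t has hst htb (hts.trans hh0) y x
      have i3 := hw₂ s t has hst htb (hts.trans hh2)
      have i4 := hw₄ s t has hst htb (hts.trans hh4)
      rw [abs_of_nonneg (sub_nonneg.2 hxy)] at i1 i2
      have i5 : |(Ψ F s t y - y) - (Ψ F s t x - x)| ≤ 1 / 2 * (y - x) := by
        have j : (Ψ F s t y - y) - (Ψ F s t x - x) = ((Ψ F s t y - μ s t y) -
          (Ψ F s t x - μ s t x)) + ((μ s t y - y) - (μ s t x - x)) := by ring
        rw [j]
        refine (abs_add_le _ _).trans ?_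
        have j1 := mul_le_mul_of_nonneg_right i3 (sub_nonneg.2 hxy)
        have j2 := mul_le_mul_of_nonneg_right i4 (sub_nonneg.2 hxy)
        linarith
      obtain ⟨i6, i7⟩ := abs_le.1 i5
      constructor <;> linarith
  -- global estimates
  have hev : ∀ s, ∀ᶠ F in (atTop : Filter (Finset ℝ)), s ∈ F := fun s =>
    (eventually_ge_atTop {s}).mono fun F hF => hF (Finset.mem_singleton_self s)
  have hcompF : ∀ F : Finset ℝ, ∀ s ∈ F, ∀ u ∈ F, ∀ t ∈ F, a ≤ s → s ≤ u → u ≤ t → t ≤ b →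
      ∀ x, Ψ F u t (Ψ F s u x) = Ψ F s t x := by
    intro F s hs u hu t ht h1 h2 h3 h4 x
    exact hΨ2 F s (Finset.mem_filter.2 ⟨hs, h1, h2.trans (h3.trans h4)⟩) u
      (Finset.mem_filter.2 ⟨hu, h1.trans h2, h3.trans h4⟩) t
      (Finset.mem_filter.2 ⟨ht, h1.trans (h2.trans h3), h4⟩) h2 h3 x
  have hglobal : ∀ k : ℕ, ∀ s t, a ≤ s → s ≤ t → t ≤ b → t - s ≤ k * h →
      ∀ᶠ F in (atTop : Filter (Finset ℝ)), ∀ x,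
      |Ψ F s t x - x| ≤ k ∧ ∀ y, x ≤ y → Ψ F s t y - Ψ F s t x ≤ 2 ^ k * (y - x) ∧
        y - x ≤ 2 ^ k * (Ψ F s t y - Ψ F s t x) := by
    intro k
    induction k with
    | zero =>
      intro s t _ hst _ hts
      obtain rfl : s = t := le_antisymm hst (by norm_num at hts; linarith)
      exact Eventually.of_forall fun F x => by simp [hΨ1]
    | succ k ih =>
      intro s t has hst htb hts
      push_cast at hts
      set u := max s (t - h)
      have hsu : s ≤ u := le_max_left _ _
      have hut : u ≤ t := max_le hst (by linarith)
      have h1 : t - u ≤ h := by linarith [le_max_right s (t - h)]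
      have h2 : u - s ≤ k * h := by
        have : u ≤ s + k * h := max_le (by nlinarith [Nat.cast_nonneg (α := ℝ) k]) (by linarith)
        linarith
      filter_upwards [ih s u has hsu (hut.trans htb) h2, hev s, hev u, hev t] with F hF hs hu ht x
      have hl := hlocal F u hu t ht (has.trans hsu) hut htb h1
      have hcF := hcompF F s hs u hu t ht has hsu hut htb
      obtain ⟨i1, i2⟩ := hF x
      obtain ⟨j1, j2⟩ := hl (Ψ F s u x)
      rw [hcF] at j1 j2
      refine ⟨?_, fun y hxy => ?_⟩
      · push_cast
        linarith [abs_sub_le (Ψ F s t x) (Ψ F s u x) x]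
      · obtain ⟨i3, i4⟩ := i2 y hxy
        have h0 : 0 ≤ Ψ F s u y - Ψ F s u x := by
          by_contra! hneg
          have : 2 ^ k * (Ψ F s u y - Ψ F s u x) < 0 := mul_neg_of_pos_of_neg (by positivity) hneg
          linarith
        obtain ⟨j3, j4⟩ := j2 (Ψ F s u y) (by linarith)
        rw [hcF] at j3 j4
        rw [pow_succ]
        constructor
        · linarith
        · have := mul_le_mul_of_nonneg_left j4 (show (0 : ℝ) ≤ 2 ^ k by positivity)
          linarith
  obtain ⟨k, hk⟩ := exists_nat_ge ((b - a) / h)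
  rw [div_le_iff₀ hh] at hk
  let U : Ultrafilter (Finset ℝ) := Ultrafilter.of atTop
  have hU : (U : Filter (Finset ℝ)) ≤ atTop := Ultrafilter.of_le _
  have hlim : ∀ s t x, ∃ l, (a ≤ s → s ≤ t → t ≤ b → Tendsto (fun F => Ψ F s t x) U (𝓝 l)) := by
    intro s t x
    by_cases hcond : a ≤ s ∧ s ≤ t ∧ t ≤ b
    · obtain ⟨h1, h2, h3⟩ := hcond
      obtain ⟨l, hl⟩ := exists_tendsto_ultrafilter U (g := fun F => Ψ F s t x) (M := k + |x|) (by
        filter_upwards [hU (hglobal k s t h1 h2 h3 (by linarith))] with F hF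
        have := (hF x).1
        have := abs_sub_abs_le_abs_sub (Ψ F s t x) x
        linarith)
      exact ⟨l, fun _ _ _ => hl⟩
    · exact ⟨0, fun h1 h2 h3 => absurd ⟨h1, h2, h3⟩ hcond⟩
  choose Φ hΦ using hlim
  have hcloseU : ∀ s t, a ≤ s → s ≤ t → t ≤ b → t - s ≤ h →
      (∀ x, |Φ s t x - μ s t x| ≤ C₁ * ϖ s t ^ α) ∧
      ∀ x y, |(Φ s t x - μ s t x) - (Φ s t y - μ s t y)| ≤ 4 * C₂ * ϖ s t ^ α * |x - y| := by
    intro s t h1 h2 h3 h4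
    refine ⟨fun x => ?_, fun x y => ?_⟩
    · refine le_of_tendsto ((hΦ s t x h1 h2 h3).sub_const _).abs ?_
      filter_upwards [hU (hev s), hU (hev t)] with F hs ht
      exact (hclose F s hs t ht h1 h2 h3 h4).1 x
    · refine le_of_tendsto (((hΦ s t x h1 h2 h3).sub_const _).sub
        ((hΦ s t y h1 h2 h3).sub_const _)).abs ?_
      filter_upwards [hU (hev s), hU (hev t)] with F hs ht
      exact (hclose F s hs t ht h1 h2 h3 h4).2 x y
  have hupper : ∀ s t, a ≤ s → s ≤ t → t ≤ b → ∀ᶠ F in (U : Filter (Finset ℝ)), ∀ x y,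
      |Ψ F s t y - Ψ F s t x| ≤ 2 ^ k * |y - x| := by
    intro s t h1 h2 h3
    filter_upwards [hU (hglobal k s t h1 h2 h3 (by linarith))] with F hF x y
    wlog hxy : x ≤ y generalizing x y
    · rw [abs_sub_comm, abs_sub_comm y]
      exact this y x (le_of_not_ge hxy)
    obtain ⟨i1, i2⟩ := (hF x).2 y hxy
    have h0 : 0 ≤ Ψ F s t y - Ψ F s t x := by
      by_contra! hneg
      have : 2 ^ k * (Ψ F s t y - Ψ F s t x) < 0 := mul_neg_of_pos_of_neg (by positivity) hneg
      linarith
    rwa [abs_of_nonneg h0, abs_of_nonneg (by linarith)]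
  refine ⟨Φ, h, max (2 ^ k) k, C₁ + (Λ + 4 * C₂), hh, by positivity, by positivity, ?_⟩
  refine ⟨?_, ?_, ?_, ?_, ?_, ?_, ?_, ?_⟩
  · intro s x h1 h2
    refine tendsto_nhds_unique (hΦ s s x h1 le_rfl h2) ?_
    simp [hΨ1]
  · intro s u t h1 h2 h3 h4 x
    have l1 := hΦ s u x h1 h2 (h3.trans h4)
    have l2 := hΦ u t (Φ s u x) (h1.trans h2) h3 h4
    have l3 := hΦ s t x h1 (h2.trans h3) h4
    have l4 : Tendsto (fun F => Ψ F s t x - Ψ F u t (Φ s u x)) U (𝓝 0) := by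
      have l5 : Tendsto (fun F => 2 ^ k * |Ψ F s u x - Φ s u x|) U (𝓝 0) := by
        simpa using ((l1.sub_const (Φ s u x)).abs).const_mul ((2 : ℝ) ^ k)
      refine squeeze_zero_norm' ?_ l5
      filter_upwards [hupper u t (h1.trans h2) h3 h4, hU (hev s), hU (hev u), hU (hev t)]
        with F hF hs hu ht
      rw [← hcompF F s hs u hu t ht h1 h2 h3 h4]
      exact hF _ _
    have := tendsto_nhds_unique (l3.sub l2) l4
    linarith
  · intro s t h1 h2 h3 x y hxy
    refine le_of_tendsto ((hΦ s t y h1 h2 h3).sub (hΦ s t x h1 h2 h3)) ?_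
    filter_upwards [hU (hglobal k s t h1 h2 h3 (by linarith))] with F hF
    refine ((hF x).2 y hxy).1.trans ?_
    have := sub_nonneg.2 hxy
    gcongr
    exact le_max_left _ _
  · intro s t h1 h2 h3 x y hxy
    have hl : Tendsto (fun F => 2 ^ k * (Ψ F s t y - Ψ F s t x)) U
      (𝓝 (2 ^ k * (Φ s t y - Φ s t x))) :=
      ((hΦ s t y h1 h2 h3).sub (hΦ s t x h1 h2 h3)).const_mul ((2 : ℝ) ^ k)
    have hle : y - x ≤ 2 ^ k * (Φ s t y - Φ s t x) := by
      refine ge_of_tendsto hl ?_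
      filter_upwards [hU (hglobal k s t h1 h2 h3 (by linarith))] with F hF
      exact ((hF x).2 y hxy).2
    have h0 : 0 ≤ Φ s t y - Φ s t x := by
      by_contra! hneg
      have : 2 ^ k * (Φ s t y - Φ s t x) < 0 := mul_neg_of_pos_of_neg (by positivity) hneg
      linarith
    refine hle.trans ?_
    gcongr
    exact le_max_left _ _
  · intro s t h1 h2 h3 x
    refine le_of_tendsto ((hΦ s t x h1 h2 h3).sub_const x).abs ?_
    filter_upwards [hU (hglobal k s t h1 h2 h3 (by linarith))] with F hF
    exact (hF x).1.trans (le_max_right _ _)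
  · intro s t h1 h2 h3 h4 x
    refine ((hcloseU s t h1 h2 h3 h4).1 x).trans ?_
    have := hϖ.nonneg s t h1 h2 h3
    gcongr
    linarith
  · intro s t h1 h2 h3 h4 x
    have i1 := (hcloseU s t h1 h2 h3 h4).1 x
    have i2 := hμ.disp s t h1 h2 h3 (h4.trans hh0) x
    have i3 := hϖ.nonneg s t h1 h2 h3
    have i4 := abs_sub_le (Φ s t x) (μ s t x) x
    have i5 := Real.rpow_nonneg i3 β
    have i6 := Real.rpow_nonneg i3 α
    nlinarith [mul_nonneg hC₁ i5, mul_nonneg hC₂ i5, mul_nonneg hC₂ i6, mul_nonneg hΛ i6]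
  · intro s t h1 h2 h3 h4 x y
    have i1 := (hcloseU s t h1 h2 h3 h4).2 x y
    have i2 := hμ.lip s t h1 h2 h3 (h4.trans hh0) x y
    have i3 := hϖ.nonneg s t h1 h2 h3
    have i4 : (Φ s t x - x) - (Φ s t y - y) = ((Φ s t x - μ s t x) -
      (Φ s t y - μ s t y)) + ((μ s t x - x) - (μ s t y - y)) := by ring
    rw [i4]
    refine (abs_add_le _ _).trans ((add_le_add i1 i2).trans ?_)
    rw [← add_mul]
    gcongr
    have := Real.rpow_nonneg i3 β
    have := Real.rpow_nonneg i3 α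
    nlinarith [mul_nonneg hC₁ (Real.rpow_nonneg i3 β), mul_nonneg hC₁ (Real.rpow_nonneg i3 α),
      mul_nonneg hC₂ (Real.rpow_nonneg i3 β), mul_nonneg hΛ (Real.rpow_nonneg i3 α)]

/-! ### Functions with bounded derivatives -/

/-- `g` is `n` times differentiable, and bounded by `K` together with its derivatives of order at
most `n`. -/
def Bd : ℕ → ℝ → (ℝ → ℝ) → Prop
  | 0, K, g => ∀ x, |g x| ≤ K
  | n + 1, K, g => (∀ x, |g x| ≤ K) ∧ Differentiable ℝ g ∧ Bd n K (deriv g)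

namespace Bd

variable {n : ℕ} {K K' : ℝ} {g h : ℝ → ℝ}

lemma bound (hg : Bd n K g) (x : ℝ) : |g x| ≤ K := by
  cases n with
  | zero => exact hg x
  | succ n => exact hg.1 x

lemma nonneg (hg : Bd n K g) : 0 ≤ K := (abs_nonneg _).trans (hg.bound 0)

lemma mono (hg : Bd n K g) (hK : K ≤ K') : Bd n K' g := by
  induction n generalizing g with
  | zero => exact fun x => (hg x).trans hK
  | succ n ih => exact ⟨fun x => (hg.1 x).trans hK, hg.2.1, ih hg.2.2⟩

lemma of_succ (hg : Bd (n + 1) K g) : Bd n K g := by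
  induction n generalizing g with
  | zero => exact hg.1
  | succ n ih => exact ⟨hg.1, hg.2.1, ih hg.2.2⟩

lemma add (hg : Bd n K g) (hh : Bd n K' h) : Bd n (K + K') (fun x => g x + h x) := by
  induction n generalizing g h with
  | zero => exact fun x => (abs_add_le _ _).trans (add_le_add (hg x) (hh x))
  | succ n ih =>
    refine ⟨fun x => (abs_add_le _ _).trans (add_le_add (hg.1 x) (hh.1 x)),
      hg.2.1.add hh.2.1, ?_⟩
    have : deriv (fun x => g x + h x) = fun x => deriv g x + deriv h x :=
      funext fun x => deriv_fun_add (hg.2.1 x) (hh.2.1 x)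
    rw [this]
    exact ih hg.2.2 hh.2.2

lemma zero : Bd n 0 (fun _ => 0) := by
  induction n with
  | zero => exact fun x => by simp
  | succ n ih => exact ⟨fun x => by simp, differentiable_const 0, by simpa using ih⟩

lemma mul_const (hg : Bd n K g) (c : ℝ) : Bd n (K * |c|) (fun x => g x * c) := by
  induction n generalizing g with
  | zero => exact fun x => by rw [abs_mul]; exact mul_le_mul_of_nonneg_right (hg x) (abs_nonneg c)
  | succ n ih =>
    refine ⟨fun x => by rw [abs_mul]; exact mul_le_mul_of_nonneg_right (hg.1 x) (abs_nonneg c),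
      hg.2.1.mul_const c, ?_⟩
    have : deriv (fun x => g x * c) = fun x => deriv g x * c :=
      funext fun x => deriv_mul_const (hg.2.1 x) c
    rw [this]
    exact ih hg.2.2

lemma mul (hg : Bd n K g) (hh : Bd n K' h) : Bd n (2 ^ n * (K * K')) (fun x => g x * h x) := by
  have hK := hg.nonneg
  have hK' := hh.nonneg
  induction n generalizing g h with
  | zero =>
    intro x
    rw [abs_mul, pow_zero, one_mul]
    exact mul_le_mul (hg x) (hh x) (abs_nonneg _) hK
  | succ n ih =>
    refine ⟨fun x => ?_, hg.2.1.mul hh.2.1, ?_⟩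
    · rw [abs_mul]
      refine (mul_le_mul (hg.1 x) (hh.1 x) (abs_nonneg _) hK).trans ?_
      exact le_mul_of_one_le_left (by positivity) (one_le_pow₀ (by norm_num))
    · have : deriv (fun x => g x * h x) = fun x => deriv g x * h x + g x * deriv h x :=
        funext fun x => deriv_fun_mul (hg.2.1 x) (hh.2.1 x)
      rw [this]
      exact ((ih hg.2.2 hh.of_succ).add (ih hg.of_succ hh.2.2)).mono (le_of_eq (by ring))

lemma sum {ι : Type*} (S : Finset ι) {g : ι → ℝ → ℝ} {K : ι → ℝ} (hg : ∀ i, Bd n (K i) (g i)) :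
    Bd n (∑ i ∈ S, K i) (fun x => ∑ i ∈ S, g i x) := by
  classical
  induction S using Finset.induction_on with
  | empty => simpa using Bd.zero
  | insert i S hi ih =>
    simp only [Finset.sum_insert hi]
    exact (hg i).add ih

lemma lipschitz (hg : Bd (n + 1) K g) (x y : ℝ) : |g x - g y| ≤ K * |x - y| :=
  Convex.norm_image_sub_le_of_norm_deriv_le (s := univ) (fun z _ => hg.2.1 z)
    (fun z _ => hg.2.2.bound z) convex_univ (mem_univ y) (mem_univ x)

lemma taylor (hg : Bd (n + 2) K g) (x v : ℝ) :
    |g (x + v) - g x - deriv g x * v| ≤ K * v ^ 2 := by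
  have h1 : ∀ z ∈ uIcc x (x + v), HasDerivWithinAt (fun u => g u - deriv g x * u)
      (deriv g z - deriv g x) (uIcc x (x + v)) z := by
    intro z _
    have h0 := (hasDerivAt_id' z).const_mul (deriv g x)
    rw [mul_one] at h0
    exact ((hg.2.1 z).hasDerivAt.sub h0).hasDerivWithinAt
  have h2 : ∀ z ∈ uIcc x (x + v), ‖deriv g z - deriv g x‖ ≤ K * |v| := by
    intro z hz
    refine (hg.2.2.lipschitz z x).trans ?_
    have := hg.nonneg
    have h3 := abs_sub_left_of_mem_uIcc hz
    rw [add_sub_cancel_left] at h3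
    gcongr
  have h3 := Convex.norm_image_sub_le_of_norm_hasDerivWithin_le h1 h2 (convex_uIcc x (x + v))
    left_mem_uIcc right_mem_uIcc
  rw [Real.norm_eq_abs, Real.norm_eq_abs, add_sub_cancel_left, mul_assoc, abs_mul_abs_self] at h3
  calc _ = |g (x + v) - deriv g x * (x + v) - (g x - deriv g x * x)| := by congr 1; ring
    _ ≤ _ := h3
    _ = _ := by ring

lemma four_point (hg : Bd (n + 2) K g) (x x' y y' : ℝ) :
    |g x - g x' - (g y - g y')| ≤
      K * (|x - x' - (y - y')| + |x - x'| * (|x - y| + |x' - y'|)) := by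
  set P : ℝ → ℝ := fun θ => x' + θ * (x - x')
  set Q : ℝ → ℝ := fun θ => y' + θ * (y - y')
  have hK := hg.nonneg
  have hP : ∀ θ, HasDerivAt P (x - x') θ := fun θ => by
    have := ((hasDerivAt_id' θ).mul_const (x - x')).const_add x'
    rwa [one_mul] at this
  have hQ : ∀ θ, HasDerivAt Q (y - y') θ := fun θ => by
    have := ((hasDerivAt_id' θ).mul_const (y - y')).const_add y'
    rwa [one_mul] at this
  have h1 : ∀ θ ∈ Icc (0 : ℝ) 1, HasDerivWithinAt (fun θ => g (P θ) - g (Q θ))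
      (deriv g (P θ) * (x - x') - deriv g (Q θ) * (y - y')) (Icc 0 1) θ := fun θ _ =>
    (((hg.2.1 (P θ)).hasDerivAt.comp θ (hP θ)).sub
      ((hg.2.1 (Q θ)).hasDerivAt.comp θ (hQ θ))).hasDerivWithinAt
  have h2 : ∀ θ ∈ Icc (0 : ℝ) 1, ‖deriv g (P θ) * (x - x') - deriv g (Q θ) * (y - y')‖ ≤
      K * (|x - x' - (y - y')| + |x - x'| * (|x - y| + |x' - y'|)) := by
    intro θ hθ
    have e : deriv g (P θ) * (x - x') - deriv g (Q θ) * (y - y') =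
      deriv g (Q θ) * (x - x' - (y - y')) + (deriv g (P θ) - deriv g (Q θ)) * (x - x') := by ring
    have e1 : |P θ - Q θ| ≤ |x - y| + |x' - y'| := by
      have : P θ - Q θ = θ * (x - y) + (1 - θ) * (x' - y') := by simp only [P, Q]; ring
      rw [this]
      refine (abs_add_le _ _).trans ?_
      rw [abs_mul, abs_mul, abs_of_nonneg hθ.1, abs_of_nonneg (sub_nonneg.2 hθ.2)]
      exact add_le_add (mul_le_of_le_one_left (abs_nonneg _) hθ.2)
        (mul_le_of_le_one_left (abs_nonneg _) (by linarith [hθ.1]))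
    rw [e, Real.norm_eq_abs]
    refine (abs_add_le _ _).trans ?_
    rw [abs_mul, abs_mul, mul_add]
    refine add_le_add (mul_le_mul_of_nonneg_right (hg.2.2.bound _) (abs_nonneg _)) ?_
    calc |deriv g (P θ) - deriv g (Q θ)| * |x - x'|
        ≤ K * (|x - y| + |x' - y'|) * |x - x'| :=
          mul_le_mul_of_nonneg_right ((hg.2.2.lipschitz _ _).trans (by gcongr)) (abs_nonneg _)
      _ = _ := by ring
  have h3 := Convex.norm_image_sub_le_of_norm_hasDerivWithin_le h1 h2 (convex_Icc 0 1)
    (left_mem_Icc.2 zero_le_one) (right_mem_Icc.2 zero_le_one)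
  simp only [P, Q, Real.norm_eq_abs, one_mul, zero_mul, add_zero, add_sub_cancel, sub_zero,
    abs_one, mul_one] at h3
  refine le_trans (le_of_eq ?_) h3
  congr 1; ring

lemma taylor_remainder {C R : ℝ} (hg : Bd 3 C g) (hh : Bd 1 R h) :
    Bd 1 (2 * C * R ^ 2) (fun x => g (x + h x) - g x - deriv g x * h x) := by
  have hC := hg.nonneg
  have hR := hh.nonneg
  have hsq : ∀ x, h x ^ 2 ≤ R ^ 2 := fun x => sq_le_sq' (abs_le.1 (hh.1 x)).1 (abs_le.1 (hh.1 x)).2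
  have hd : ∀ x, HasDerivAt (fun x => g (x + h x) - g x - deriv g x * h x)
      (deriv g (x + h x) * (1 + deriv h x) - deriv g x -
        (deriv (deriv g) x * h x + deriv g x * deriv h x)) x := by
    intro x
    have h1 := (hh.2.1 x).hasDerivAt
    have h2 : HasDerivAt (fun x => x + h x) (1 + deriv h x) x := (hasDerivAt_id x).add h1
    exact (((hg.2.1 (x + h x)).hasDerivAt.comp x h2).sub (hg.2.1 x).hasDerivAt).sub
      ((hg.2.2.2.1 x).hasDerivAt.mul h1)
  refine ⟨fun x => ?_, fun x => (hd x).differentiableAt, fun x => ?_⟩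
  · refine (hg.taylor x (h x)).trans ?_
    have := mul_le_mul_of_nonneg_left (hsq x) hC
    nlinarith [mul_nonneg hC (sq_nonneg R)]
  · rw [(hd x).deriv]
    have e : deriv g (x + h x) * (1 + deriv h x) - deriv g x -
        (deriv (deriv g) x * h x + deriv g x * deriv h x) =
        (deriv g (x + h x) - deriv g x - deriv (deriv g) x * h x) +
          (deriv g (x + h x) - deriv g x) * deriv h x := by ring
    rw [e]
    refine (abs_add_le _ _).trans ?_
    have e1 := (hg.2.2.taylor x (h x)).trans (mul_le_mul_of_nonneg_left (hsq x) hC)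
    have e2 := hg.2.2.lipschitz (x + h x) x
    rw [add_sub_cancel_left] at e2
    have e3 := e2.trans (mul_le_mul_of_nonneg_left (hh.1 x) hC)
    rw [abs_mul]
    have e4 := mul_le_mul e3 (hh.2.2 x) (abs_nonneg _) (by positivity)
    nlinarith

lemma shift_sub {C R : ℝ} (hg : Bd 2 C g) (hh : Bd 1 R h) :
    Bd 1 (2 * C * R) (fun x => g (x + h x) - g x) := by
  have hC := hg.nonneg
  have hR := hh.nonneg
  have hd : ∀ x, HasDerivAt (fun x => g (x + h x) - g x)
      (deriv g (x + h x) * (1 + deriv h x) - deriv g x) x := by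
    intro x
    have h2 : HasDerivAt (fun x => x + h x) (1 + deriv h x) x :=
      (hasDerivAt_id x).add (hh.2.1 x).hasDerivAt
    exact ((hg.2.1 (x + h x)).hasDerivAt.comp x h2).sub (hg.2.1 x).hasDerivAt
  refine ⟨fun x => ?_, fun x => (hd x).differentiableAt, fun x => ?_⟩
  · have e2 := hg.lipschitz (x + h x) x
    rw [add_sub_cancel_left] at e2
    have e3 := e2.trans (mul_le_mul_of_nonneg_left (hh.1 x) hC)
    nlinarith [mul_nonneg hC hR]
  · rw [(hd x).deriv]
    have e : deriv g (x + h x) * (1 + deriv h x) - deriv g x =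
        (deriv g (x + h x) - deriv g x) + deriv g (x + h x) * deriv h x := by ring
    rw [e]
    refine (abs_add_le _ _).trans ?_
    have e2 := hg.2.2.lipschitz (x + h x) x
    rw [add_sub_cancel_left] at e2
    have e3 := e2.trans (mul_le_mul_of_nonneg_left (hh.1 x) hC)
    rw [abs_mul]
    have e4 := mul_le_mul (hg.2.2.bound (x + h x)) (hh.2.2 x) (abs_nonneg _) hC
    linarith

end Bd

/-! ### The approximate flow of a rough differential equation -/

section Davie

variable {N : ℕ} (f : ℝ → EuclideanSpace ℝ (Fin N) →L[ℝ] ℝ)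

/-- The first order term `f(ξ) v`. -/
noncomputable def term₁ (v : EuclideanSpace ℝ (Fin N)) : ℝ → ℝ :=
  fun ξ => ∑ i, comp f i ξ * v i

/-- The second order term `f₂(ξ) w`. -/
noncomputable def term₂ (w : EuclideanSpace ℝ (Fin N × Fin N)) : ℝ → ℝ :=
  fun ξ => ∑ i, ∑ j, comp₂ f i j ξ * w (i, j)

/-- The second order Euler scheme of the equation `dy = f(y) dX`. -/
noncomputable def euler (X₁ : ℝ → ℝ → EuclideanSpace ℝ (Fin N))
    (X₂ : ℝ → ℝ → EuclideanSpace ℝ (Fin N × Fin N)) (s t ξ : ℝ) : ℝ :=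
  ξ + (term₁ f (X₁ s t) ξ + term₂ f (X₂ s t) ξ)

variable {f}

lemma IsCb3.bd_comp (hf : IsCb3 f) : ∃ K : ℝ, 0 ≤ K ∧ ∀ i, Bd 3 K (comp f i) := by
  choose! C hC using hf.bounded
  have hC0 : ∀ k ≤ 3, 0 ≤ C k := fun k hk => (norm_nonneg _).trans (hC k hk 0)
  refine ⟨∑ k ∈ Finset.range 4, C k, Finset.sum_nonneg fun k hk =>
    hC0 k (by have := Finset.mem_range.1 hk; omega), fun i => ?_⟩
  have hle : ∀ k ≤ 3, C k ≤ ∑ k ∈ Finset.range 4, C k := fun k hk =>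
    Finset.single_le_sum (f := C) (fun j hj => hC0 j (by have := Finset.mem_range.1 hj; omega))
      (Finset.mem_range.2 (by omega))
  have key : ∀ n k : ℕ, n + k ≤ 3 → Bd n (∑ k ∈ Finset.range 4, C k)
      (fun ξ => iteratedDeriv k f ξ (EuclideanSpace.single i 1)) := by
    intro n
    have hb : ∀ k : ℕ, k ≤ 3 → ∀ ξ, |iteratedDeriv k f ξ (EuclideanSpace.single i 1)| ≤
        ∑ k ∈ Finset.range 4, C k := by
      intro k hk ξ
      refine ((iteratedDeriv k f ξ).le_opNorm _).trans ?_
      rw [PiLp.norm_single, norm_one, mul_one]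
      exact (hC k hk ξ).trans (hle k hk)
    induction n with
    | zero => exact fun k hk => hb k (by omega)
    | succ n ih =>
      intro k hk
      have hd : ∀ ξ, HasDerivAt (fun ξ => iteratedDeriv k f ξ (EuclideanSpace.single i 1))
          (iteratedDeriv (k + 1) f ξ (EuclideanSpace.single i 1)) ξ := by
        intro ξ
        have h1 := (hf.differentiable k (by omega) ξ).hasDerivAt
        rw [← iteratedDeriv_succ] at h1
        simpa using h1.clm_apply (hasDerivAt_const ξ (EuclideanSpace.single i (1 : ℝ)))
      refine ⟨hb k (by omega), fun ξ => (hd ξ).differentiableAt, ?_⟩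
      rw [show deriv (fun ξ => iteratedDeriv k f ξ (EuclideanSpace.single i 1)) =
        fun ξ => iteratedDeriv (k + 1) f ξ (EuclideanSpace.single i 1) from
        funext fun ξ => (hd ξ).deriv]
      exact ih (k + 1) (by omega)
  have := key 3 0 le_rfl
  rwa [iteratedDeriv_zero] at this

lemma IsCb3.bd_term (hf : IsCb3 f) : ∃ L : ℝ, 0 ≤ L ∧ (∀ v, Bd 3 (L * ‖v‖) (term₁ f v)) ∧
    ∀ w, Bd 2 (L * ‖w‖) (term₂ f w) := by
  obtain ⟨K, hK, h⟩ := hf.bd_comp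
  refine ⟨N * K + N * (N * (2 ^ 2 * (K * K))), by positivity, fun v => ?_, fun w => ?_⟩
  · refine (Bd.sum Finset.univ fun i => (h i).mul_const (v i)).mono ?_
    calc ∑ i, K * |v i| ≤ ∑ _i : Fin N, K * ‖v‖ :=
          Finset.sum_le_sum fun i _ => mul_le_mul_of_nonneg_left (PiLp.norm_apply_le v i) hK
      _ = N * K * ‖v‖ := by simp [mul_assoc]
      _ ≤ _ := by gcongr; exact le_add_of_nonneg_right (by positivity)
  · refine (Bd.sum Finset.univ fun i => Bd.sum Finset.univ fun j =>
      (((h i).of_succ).mul (h j).2.2).mul_const (w (i, j))).mono ?_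
    calc ∑ i, ∑ j, 2 ^ 2 * (K * K) * |w (i, j)|
        ≤ ∑ _i : Fin N, ∑ _j : Fin N, 2 ^ 2 * (K * K) * ‖w‖ :=
          Finset.sum_le_sum fun i _ => Finset.sum_le_sum fun j _ =>
            mul_le_mul_of_nonneg_left (PiLp.norm_apply_le w (i, j)) (by positivity)
      _ = N * (N * (2 ^ 2 * (K * K))) * ‖w‖ := by simp [mul_assoc]
      _ ≤ _ := by gcongr; exact le_add_of_nonneg_left (by positivity)

lemma term₁_add (v w : EuclideanSpace ℝ (Fin N)) (ξ : ℝ) :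
    term₁ f (v + w) ξ = term₁ f v ξ + term₁ f w ξ := by
  simp [term₁, mul_add, Finset.sum_add_distrib]

lemma term₂_chen (hf : IsCb3 f) {v v' : EuclideanSpace ℝ (Fin N)}
    {w w' z : EuclideanSpace ℝ (Fin N × Fin N)}
    (hz : ∀ i j, z (i, j) = w (i, j) + w' (i, j) + v i * v' j) (ξ : ℝ) :
    term₂ f z ξ = term₂ f w ξ + term₂ f w' ξ + term₁ f v ξ * deriv (term₁ f v') ξ := by
  obtain ⟨K, -, h⟩ := hf.bd_comp
  have hd : deriv (term₁ f v') ξ = ∑ j, deriv (comp f j) ξ * v' j := by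
    have : HasDerivAt (term₁ f v') (∑ j, deriv (comp f j) ξ * v' j) ξ :=
      HasDerivAt.fun_sum fun j _ => ((h j).2.1 ξ).hasDerivAt.mul_const (v' j)
    exact this.deriv
  rw [hd]
  simp only [term₁, term₂, comp₂, hz, Finset.sum_mul_sum, mul_add, Finset.sum_add_distrib]
  congr 1
  exact Finset.sum_congr rfl fun i _ => Finset.sum_congr rfl fun j _ => by ring

/-- The second order Euler scheme is an approximate flow. -/
lemma IsCb3.isApproxFlow (hf : IsCb3 f) {p T : ℝ} (hp : 0 < p)
    {X₁ : ℝ → ℝ → EuclideanSpace ℝ (Fin N)} {X₂ : ℝ → ℝ → EuclideanSpace ℝ (Fin N × Fin N)}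
    {ϖ : ℝ → ℝ → ℝ} (hϖ : IsControl ϖ 0 T)
    (hX₁ : ∀ s u t, 0 ≤ s → s ≤ u → u ≤ t → t ≤ T → X₁ s t = X₁ s u + X₁ u t)
    (hX₂ : ∀ s u t, 0 ≤ s → s ≤ u → u ≤ t → t ≤ T → ∀ i j,
      X₂ s t (i, j) = X₂ s u (i, j) + X₂ u t (i, j) + X₁ s u i * X₁ u t j)
    (hn₁ : ∀ s t, 0 ≤ s → s ≤ t → t ≤ T → ‖X₁ s t‖ ≤ ϖ s t ^ (1 / p))
    (hn₂ : ∀ s t, 0 ≤ s → s ≤ t → t ≤ T → ‖X₂ s t‖ ≤ ϖ s t ^ (2 / p)) :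
    ∃ η Λ K : ℝ, 0 < η ∧ 0 ≤ Λ ∧ 0 ≤ K ∧
      IsApproxFlow (euler f X₁ X₂) ϖ 0 T η (3 / p) (1 / p) Λ K := by
  obtain ⟨L, hL, h1, h2⟩ := hf.bd_term
  obtain ⟨η, hη, hη'⟩ := hϖ.regular 1 one_pos
  have hpow : ∀ s t, 0 ≤ s → s ≤ t → t ≤ T → ∀ k : ℕ, ϖ s t ^ ((k : ℝ) / p) =
      (ϖ s t ^ (1 / p)) ^ k := by
    intro s t hs hst ht k
    rw [← Real.rpow_mul_natCast (hϖ.nonneg s t hs hst ht)]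
    congr 1; ring
  have hb₁ : ∀ s t, 0 ≤ s → s ≤ t → t ≤ T → Bd 3 (L * ϖ s t ^ (1 / p)) (term₁ f (X₁ s t)) :=
    fun s t hs hst ht => (h1 _).mono (mul_le_mul_of_nonneg_left (hn₁ s t hs hst ht) hL)
  have hb₂ : ∀ s t, 0 ≤ s → s ≤ t → t ≤ T →
      Bd 2 (L * (ϖ s t ^ (1 / p)) ^ 2) (term₂ f (X₂ s t)) := fun s t hs hst ht =>
    (h2 _).mono (mul_le_mul_of_nonneg_left ((hn₂ s t hs hst ht).trans
      (le_of_eq (by exact_mod_cast hpow s t hs hst ht 2))) hL)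
  have hρ : ∀ s t, 0 ≤ s → s ≤ t → t ≤ T → t - s ≤ η →
      0 ≤ ϖ s t ^ (1 / p) ∧ ϖ s t ^ (1 / p) ≤ 1 := fun s t hs hst ht hts =>
    ⟨Real.rpow_nonneg (hϖ.nonneg s t hs hst ht) _,
      Real.rpow_le_one (hϖ.nonneg s t hs hst ht) (hη' s t hs hst ht hts) (by positivity)⟩
  have hb : ∀ s t, 0 ≤ s → s ≤ t → t ≤ T → t - s ≤ η → Bd 2 (2 * L * ϖ s t ^ (1 / p))
      (fun ξ => term₁ f (X₁ s t) ξ + term₂ f (X₂ s t) ξ) := by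
    intro s t hs hst ht hts
    refine (((hb₁ s t hs hst ht).of_succ).add (hb₂ s t hs hst ht)).mono ?_
    obtain ⟨h3, h4⟩ := hρ s t hs hst ht hts
    have : (ϖ s t ^ (1 / p)) ^ 2 ≤ ϖ s t ^ (1 / p) := by nlinarith
    nlinarith
  have hdef : ∀ s u t, 0 ≤ s → s ≤ u → u ≤ t → t ≤ T → t - s ≤ η →
      Bd 1 ((8 * L ^ 3 + 6 * L ^ 2) * ϖ s t ^ (3 / p))
        (fun ξ => euler f X₁ X₂ u t (euler f X₁ X₂ s u ξ) - euler f X₁ X₂ s t ξ) := by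
    intro s u t hs hsu hut ht hts
    set ρ := ϖ s t ^ (1 / p)
    have hρ0 : 0 ≤ ρ := (hρ s t hs (hsu.trans hut) ht hts).1
    have hle1 : ϖ s u ^ (1 / p) ≤ ρ :=
      Real.rpow_le_rpow (hϖ.nonneg s u hs hsu (hut.trans ht))
        (hϖ.mono hs le_rfl hsu hut ht) (by positivity)
    have hle2 : ϖ u t ^ (1 / p) ≤ ρ :=
      Real.rpow_le_rpow (hϖ.nonneg u t (hs.trans hsu) hut ht)
        (hϖ.mono hs hsu hut le_rfl ht) (by positivity)
    have hn1 := (hρ s u hs hsu (hut.trans ht) (by linarith)).1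
    have hn2 := (hρ u t (hs.trans hsu) hut ht (by linarith)).1
    have c1 : Bd 1 (2 * L * ρ) (fun ξ => term₁ f (X₁ s u) ξ + term₂ f (X₂ s u) ξ) :=
      ((hb s u hs hsu (hut.trans ht) (by linarith)).of_succ).mono (by gcongr)
    have c2 : Bd 3 (L * ρ) (term₁ f (X₁ u t)) :=
      (hb₁ u t (hs.trans hsu) hut ht).mono (by gcongr)
    have c3 : Bd 2 (L * ρ ^ 2) (term₂ f (X₂ s u)) :=
      (hb₂ s u hs hsu (hut.trans ht)).mono (by gcongr)
    have c4 : Bd 2 (L * ρ ^ 2) (term₂ f (X₂ u t)) :=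
      (hb₂ u t (hs.trans hsu) hut ht).mono (by gcongr)
    have c5 := ((c2.taylor_remainder c1).add (c2.2.2.of_succ.mul c3.of_succ)).add
      (c4.shift_sub c1)
    have h3 : ϖ s t ^ (3 / p) = ρ ^ 3 := by
      exact_mod_cast hpow s t hs (hsu.trans hut) ht 3
    rw [h3]
    have e : (fun ξ => euler f X₁ X₂ u t (euler f X₁ X₂ s u ξ) - euler f X₁ X₂ s t ξ) =
        fun ξ => ((term₁ f (X₁ u t) (ξ + (term₁ f (X₁ s u) ξ + term₂ f (X₂ s u) ξ)) -
          term₁ f (X₁ u t) ξ - deriv (term₁ f (X₁ u t)) ξ *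
            (term₁ f (X₁ s u) ξ + term₂ f (X₂ s u) ξ)) +
          deriv (term₁ f (X₁ u t)) ξ * term₂ f (X₂ s u) ξ) +
          (term₂ f (X₂ u t) (ξ + (term₁ f (X₁ s u) ξ + term₂ f (X₂ s u) ξ)) -
            term₂ f (X₂ u t) ξ) := by
      funext ξ
      simp only [euler]
      rw [hX₁ s u t hs hsu hut ht, term₁_add,
        term₂_chen hf (hX₂ s u t hs hsu hut ht) ξ]
      ring
    rw [e]
    exact c5.mono (le_of_eq (by ring))
  refine ⟨η, 2 * L, 8 * L ^ 3 + 6 * L ^ 2, hη, by positivity, by positivity, ?_⟩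
  refine ⟨?_, ?_, ?_, ?_, ?_, ?_⟩
  · intro s x h3 h4
    have := (hb s s h3 le_rfl h4 (by linarith)).bound x
    rw [hϖ.self h3 h4, Real.zero_rpow (by positivity), mul_zero] at this
    rw [euler, abs_nonpos_iff.1 this, add_zero]
  · intro s t h3 h4 h5 h6 x
    simpa [euler] using (hb s t h3 h4 h5 h6).bound x
  · intro s t h3 h4 h5 h6 x y
    simpa [euler] using (hb s t h3 h4 h5 h6).lipschitz x y
  · intro s t h3 h4 h5 h6 x x' y y'
    simpa [euler] using (hb s t h3 h4 h5 h6).four_point x x' y y'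
  · intro s u t h3 h4 h5 h6 h7 x
    exact (hdef s u t h3 h4 h5 h6 h7).bound x
  · intro s u t h3 h4 h5 h6 h7 x y
    exact (hdef s u t h3 h4 h5 h6 h7).lipschitz x y

end Davie

section Geometric

variable {N : ℕ} {p T : ℝ} {X₁ : ℝ → ℝ → EuclideanSpace ℝ (Fin N)}
  {X₂ : ℝ → ℝ → EuclideanSpace ℝ (Fin N × Fin N)}

lemma IsGeometricRoughPath.add (hp : 0 < p) (hX : IsGeometricRoughPath p T X₁ X₂) {s u t : ℝ}
    (hs : 0 ≤ s) (hsu : s ≤ u) (hut : u ≤ t) (ht : t ≤ T) : X₁ s t = X₁ s u + X₁ u t := by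
  obtain ⟨x, Z₁, Z₂, hZ, hlim, -⟩ := hX.approx
  have key : ∀ s t, 0 ≤ s → s ≤ t → t ≤ T →
      Tendsto (fun n => incr (x n) s t) atTop (𝓝 (X₁ s t)) := by
    intro s t hs hst ht
    rw [tendsto_iff_edist_tendsto_0]
    refine tendsto_of_tendsto_of_tendsto_of_le_of_le tendsto_const_nhds hlim
      (fun _ => zero_le) fun n => ?_
    have h1 : ‖(Z₁ n - X₁) s t‖ₑ ^ p ≤ varControl p (Z₁ n - X₁) 0 T :=
      (enorm_rpow_le_varControl hst).trans (varControl_mono hs ht)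
    have h2 := ENNReal.rpow_le_rpow h1 (show 0 ≤ 1 / p by positivity)
    rw [← ENNReal.rpow_mul, mul_one_div_cancel hp.ne', ENNReal.rpow_one] at h2
    dsimp only
    rw [edist_eq_enorm_sub, ← (hZ n).level₁ s t hs hst ht]
    exact h2
  refine tendsto_nhds_unique (key s t hs (hsu.trans hut) ht) ?_
  refine ((key s u hs hsu (hut.trans ht)).add (key u t (hs.trans hsu) hut ht)).congr fun n => ?_
  simp [incr]

lemma IsRoughPath.exists_control (hp : 0 < p) (hX : IsRoughPath p T X₁ X₂) :
    ∃ ϖ : ℝ → ℝ → ℝ, IsControl ϖ 0 T ∧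
      (∀ s t, 0 ≤ s → s ≤ t → t ≤ T → ‖X₁ s t‖ ≤ ϖ s t ^ (1 / p)) ∧
      ∀ s t, 0 ≤ s → s ≤ t → t ≤ T → ‖X₂ s t‖ ≤ ϖ s t ^ (2 / p) := by
  have hp2 : 0 < p / 2 := by linarith
  refine ⟨_, (hX.mem₁.isControl hp).add (hX.mem₂.isControl hp2), fun s t hs hst ht => ?_,
    fun s t hs hst ht => ?_⟩
  · exact (hX.mem₁.norm_le hp hs hst ht).trans (Real.rpow_le_rpow ENNReal.toReal_nonneg
      (le_add_of_nonneg_right ENNReal.toReal_nonneg) (by positivity))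
  · refine (hX.mem₂.norm_le hp2 hs hst ht).trans ?_
    rw [one_div_div]
    exact Real.rpow_le_rpow ENNReal.toReal_nonneg
      (le_add_of_nonneg_left ENNReal.toReal_nonneg) (by positivity)

/-- The flow of the equation `dy = f(y) dX`. -/
lemma IsGeometricRoughPath.exists_flow (hp : 2 ≤ p) (hp3 : p < 3)
    (hX : IsGeometricRoughPath p T X₁ X₂) {f : ℝ → EuclideanSpace ℝ (Fin N) →L[ℝ] ℝ}
    (hf : IsCb3 f) :
    ∃ (ϖ : ℝ → ℝ → ℝ) (Φ : ℝ → ℝ → ℝ → ℝ) (η B C : ℝ), IsControl ϖ 0 T ∧ 0 < η ∧ 0 < B ∧ 0 ≤ C ∧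
      IsFlowOf Φ (euler f X₁ X₂) ϖ 0 T η (3 / p) (1 / p) B C := by
  have hp0 : 0 < p := by linarith
  obtain ⟨ϖ, hϖ, hn₁, hn₂⟩ := hX.isRoughPath.exists_control hp0
  have z₁ : ∀ s, 0 ≤ s → s ≤ T → X₁ s s = 0 := fun s hs ht => by
    have := hn₁ s s hs le_rfl ht
    rw [hϖ.self hs ht, Real.zero_rpow (by positivity)] at this
    exact norm_le_zero_iff.1 this
  have z₂ : ∀ s, 0 ≤ s → s ≤ T → X₂ s s = 0 := fun s hs ht => by
    have := hn₂ s s hs le_rfl ht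
    rw [hϖ.self hs ht, Real.zero_rpow (by positivity)] at this
    exact norm_le_zero_iff.1 this
  have hX₂ : ∀ s u t, 0 ≤ s → s ≤ u → u ≤ t → t ≤ T → ∀ i j,
      X₂ s t (i, j) = X₂ s u (i, j) + X₂ u t (i, j) + X₁ s u i * X₁ u t j := by
    intro s u t hs hsu hut ht i j
    rcases hsu.eq_or_lt with rfl | hsu'
    · simp [z₁ s hs (hut.trans ht), z₂ s hs (hut.trans ht)]
    rcases hut.eq_or_lt with rfl | hut'
    · simp [z₁ u (hs.trans hsu) ht, z₂ u (hs.trans hsu) ht]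
    have := hX.isRoughPath.chen s u t hs hsu' hut' ht i j
    simp only [incr₂, PiLp.sub_apply] at this
    linarith
  have hX₁ : ∀ s u t, 0 ≤ s → s ≤ u → u ≤ t → t ≤ T → X₁ s t = X₁ s u + X₁ u t :=
    fun s u t h1 h2 h3 h4 => hX.add hp0 h1 h2 h3 h4
  obtain ⟨η, Λ, K, hη, hΛ, hK, hμ⟩ := hf.isApproxFlow hp0 hϖ hX₁ hX₂ hn₁ hn₂
  have hα : 1 < 3 / p := (one_lt_div hp0).2 hp3
  have hβ : 0 < 1 / p := one_div_pos.2 hp0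
  obtain ⟨Φ, η', B, C, h1, h2, h3, h4⟩ := hμ.exists_flow hϖ hη hα hβ hΛ hK
  exact ⟨ϖ, Φ, η', B, C, hϖ, h1, h2, h3, h4⟩

end Geometric

/-! ### Uniqueness -/

namespace IsFlowOf

variable {Φ μ : ℝ → ℝ → ℝ → ℝ} {ϖ : ℝ → ℝ → ℝ} {a b η α β B C : ℝ}

lemma strictMono (hΦ : IsFlowOf Φ μ ϖ a b η α β B C) (hB : 0 < B) {s t : ℝ} (h1 : a ≤ s)
    (h2 : s ≤ t) (h3 : t ≤ b) : StrictMono (Φ s t) := by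
  intro x y hxy
  have := hΦ.lower s t h1 h2 h3 x y hxy.le
  have h4 : 0 < B * (Φ s t y - Φ s t x) := by linarith
  exact sub_pos.1 (pos_of_mul_pos_right h4 hB.le)

lemma abs_sub_le (hΦ : IsFlowOf Φ μ ϖ a b η α β B C) (hB : 0 < B) {s t : ℝ} (h1 : a ≤ s)
    (h2 : s ≤ t) (h3 : t ≤ b) (x y : ℝ) : |Φ s t x - Φ s t y| ≤ B * |x - y| := by
  wlog hxy : y ≤ x generalizing x y
  · rw [abs_sub_comm, abs_sub_comm x]
    exact this y x (le_of_not_ge hxy)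
  have := hΦ.upper s t h1 h2 h3 y x hxy
  rwa [abs_of_nonneg (sub_nonneg.2 hxy), abs_of_nonneg
    (sub_nonneg.2 ((hΦ.strictMono hB h1 h2 h3).monotone hxy))]

lemma continuous (hΦ : IsFlowOf Φ μ ϖ a b η α β B C) (hB : 0 < B) {s t : ℝ} (h1 : a ≤ s)
    (h2 : s ≤ t) (h3 : t ≤ b) : Continuous (Φ s t) :=
  (LipschitzWith.of_dist_le_mul (K := ⟨B, hB.le⟩) fun x y =>
    hΦ.abs_sub_le hB h1 h2 h3 x y).continuous

lemma exists_disp_le (hΦ : IsFlowOf Φ μ ϖ a b η α β B C) (hϖ : IsControl ϖ a b) (hα : 0 < α)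
    (hβ : 0 < β) (hη : 0 < η) (hC : 0 ≤ C) {ε : ℝ} (hε : 0 < ε) : ∃ η' : ℝ, 0 < η' ∧
      ∀ s t, a ≤ s → s ≤ t → t ≤ b → t - s ≤ η' → ∀ x, |Φ s t x - x| ≤ ε := by
  obtain ⟨η₁, h1, h2⟩ := hϖ.exists_rpow_le hC hβ (half_pos hε)
  obtain ⟨η₂, h3, h4⟩ := hϖ.exists_rpow_le hC hα (half_pos hε)
  refine ⟨min η (min η₁ η₂), by positivity, fun s t x y z w ξ => ?_⟩
  have i1 := hΦ.disp_le s t x y z (w.trans (by simp)) ξ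
  have i2 := h2 s t x y z (w.trans (by simp))
  have i3 := h4 s t x y z (w.trans (by simp))
  linarith

/-- A continuous path pulled back to the terminal time is continuous. -/
lemma continuousOn_pullback (hΦ : IsFlowOf Φ μ ϖ a b η α β B C) (hϖ : IsControl ϖ a b)
    (hα : 0 < α) (hβ : 0 < β) (hη : 0 < η) (hB : 0 < B) (hC : 0 ≤ C) {y : ℝ → ℝ}
    (hy : ContinuousOn y (Icc a b)) : ContinuousOn (fun t => Φ t b (y t)) (Icc a b) := by
  refine continuousOn_of_modulus fun ε hε => ?_
  have hε' : 0 < ε / (2 * B) := by positivity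
  obtain ⟨η₁, h1, h2⟩ := hΦ.exists_disp_le hϖ hα hβ hη hC hε'
  obtain ⟨η₂, h3, h4⟩ := Metric.uniformContinuousOn_iff.1
    (isCompact_Icc.uniformContinuousOn_of_continuous hy) _ hε'
  refine ⟨min η₁ (η₂ / 2), by positivity, fun s t i j k l => ?_⟩
  rw [← hΦ.comp s t b i j k le_rfl]
  refine (hΦ.abs_sub_le hB (i.trans j) k le_rfl _ _).trans ?_
  have e1 := h2 s t i j k (l.trans (min_le_left _ _)) (y s)
  have e2 := h4 t ⟨i.trans j, k⟩ s ⟨i, j.trans k⟩ (by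
    rw [Real.dist_eq, abs_of_nonneg (by linarith)]
    linarith [l.trans (min_le_right _ _)])
  rw [Real.dist_eq] at e2
  have e3 := _root_.abs_sub_le (y t) (y s) (Φ s t (y s))
  rw [abs_sub_comm (y s)] at e3
  have e4 : |y t - Φ s t (y s)| ≤ ε / B := by
    have : ε / B = ε / (2 * B) + ε / (2 * B) := by field_simp; norm_num
    linarith
  rw [le_div_iff₀ hB] at e4
  linarith

/-- A path which solves the equation up to a nondecreasing term stays above the flow. -/
lemma monotoneOn_pullback (hΦ : IsFlowOf Φ μ ϖ a b η α β B C) (hϖ : IsControl ϖ a b) (hα : 1 < α)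
    (hη : 0 < η) (hB : 0 < B) (hC : 0 ≤ C) {c d : ℝ} (hc : a ≤ c) (hd : d ≤ b) {y g : ℝ → ℝ}
    {r ϖ' : ℝ → ℝ → ℝ} (hϖ' : IsControl ϖ' c d)
    (hr : ∀ s t, c ≤ s → s ≤ t → t ≤ d → |r s t| ≤ ϖ' s t ^ α)
    (hy : ∀ s t, c ≤ s → s ≤ t → t ≤ d → y t - μ s t (y s) = g t - g s + r s t) :
    (MonotoneOn g (Icc c d) → MonotoneOn (fun t => Φ t b (y t)) (Icc c d)) ∧
    (AntitoneOn g (Icc c d) → AntitoneOn (fun t => Φ t b (y t)) (Icc c d)) := by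
  have key : ∀ s t, c ≤ s → s ≤ t → t ≤ d → t - s ≤ η →
      |y t - Φ s t (y s) - (g t - g s)| ≤ (C + 1) * (ϖ s t + ϖ' s t) ^ α := by
    intro s t i j k l
    have i1 := hΦ.close s t (hc.trans i) j (k.trans hd) l (y s)
    have i2 := hr s t i j k
    have n1 := hϖ.nonneg s t (hc.trans i) j (k.trans hd)
    have n2 := hϖ'.nonneg s t i j k
    have i3 : ϖ s t ^ α ≤ (ϖ s t + ϖ' s t) ^ α := by gcongr; linarith
    have i4 : ϖ' s t ^ α ≤ (ϖ s t + ϖ' s t) ^ α := by gcongr; linarith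
    have i5 : y t - Φ s t (y s) - (g t - g s) = r s t - (Φ s t (y s) - μ s t (y s)) := by
      linarith [hy s t i j k]
    rw [i5]
    have := abs_sub (r s t) (Φ s t (y s) - μ s t (y s))
    have := mul_le_mul_of_nonneg_left i3 hC
    linarith
  have hsum := (hϖ.restrict hc hd).add hϖ'
  constructor
  · intro hg
    refine hsum.monotoneOn_of_le_rpow (C := B * (C + 1)) hα hη (by positivity)
      fun s t i j k l => ?_
    have n1 := hsum.nonneg s t i j k
    have i1 := (abs_le.1 (key s t i j k l)).1
    have i2 := hg ⟨i, j.trans k⟩ ⟨i.trans j, k⟩ j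
    rw [← hΦ.comp s t b (hc.trans i) j (k.trans hd) le_rfl]
    rcases le_total (y t) (Φ s t (y s)) with h | h
    · refine (hΦ.upper t b (hc.trans (i.trans j)) (k.trans hd) le_rfl _ _ h).trans ?_
      rw [mul_assoc]
      gcongr
      linarith
    · have := (hΦ.strictMono hB (hc.trans (i.trans j)) (k.trans hd) le_rfl).monotone h
      have : 0 ≤ B * (C + 1) * (ϖ s t + ϖ' s t) ^ α := by positivity
      linarith
  · intro hg
    suffices MonotoneOn (fun t => -Φ t b (y t)) (Icc c d) from
      fun x hx z hz hxz => neg_le_neg_iff.1 (this hx hz hxz)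
    refine hsum.monotoneOn_of_le_rpow (C := B * (C + 1)) hα hη (by positivity)
      fun s t i j k l => ?_
    have n1 := hsum.nonneg s t i j k
    have i1 := (abs_le.1 (key s t i j k l)).2
    have i2 := hg ⟨i, j.trans k⟩ ⟨i.trans j, k⟩ j
    rw [← hΦ.comp s t b (hc.trans i) j (k.trans hd) le_rfl]
    rcases le_total (Φ s t (y s)) (y t) with h | h
    · have := hΦ.upper t b (hc.trans (i.trans j)) (k.trans hd) le_rfl _ _ h
      have : B * (y t - Φ s t (y s)) ≤ B * ((C + 1) * (ϖ s t + ϖ' s t) ^ α) := by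
        gcongr
        linarith
      linarith
    · have := (hΦ.strictMono hB (hc.trans (i.trans j)) (k.trans hd) le_rfl).monotone h
      have : 0 ≤ B * (C + 1) * (ϖ s t + ϖ' s t) ^ α := by positivity
      linarith

end IsFlowOf

/-- Comparison principle for the Skorokhod problem: a path which only grows when it is on the
obstacle is below any nondecreasing path which is above the obstacle. -/
lemma skorokhod_comparison {w v L : ℝ → ℝ} {T : ℝ} (hw : ContinuousOn w (Icc 0 T))
    (hv : ContinuousOn v (Icc 0 T)) (hvm : MonotoneOn v (Icc 0 T)) (hvL : ∀ t ∈ Icc 0 T, L t ≤ v t)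
    (hwL : ∀ s t, 0 ≤ s → s ≤ t → t ≤ T → (∀ u ∈ Icc s t, L u < w u) → w s = w t)
    (h0 : w 0 ≤ v 0) : ∀ t ∈ Icc 0 T, w t ≤ v t := by
  intro t ht
  by_contra! hlt
  have hsub : Icc 0 t ⊆ Icc 0 T := Icc_subset_Icc_right ht.2
  set S := Icc 0 t ∩ (fun u => v u - w u) ⁻¹' Ici 0
  have hS : IsCompact S :=
    isCompact_Icc.of_isClosed_subset (((hv.mono hsub).sub (hw.mono hsub)).preimage_isClosed_of_isClosed
      isClosed_Icc isClosed_Ici) inter_subset_left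
  have h0S : (0 : ℝ) ∈ S := ⟨⟨le_rfl, ht.1⟩, by simpa using h0⟩
  obtain ⟨σ, hσ, hmax⟩ := hS.exists_isGreatest ⟨0, h0S⟩
  have hσ' : w σ ≤ v σ := by simpa using hσ.2
  have hσt : σ < t := lt_of_le_of_ne hσ.1.2 (by rintro rfl; linarith)
  have hgt : ∀ u ∈ Ioc σ t, v u < w u := by
    intro u hu
    by_contra! h
    exact absurd (hmax ⟨⟨hσ.1.1.trans hu.1.le, hu.2⟩, by simpa using h⟩) (not_le.2 hu.1)
  have hconst : ∀ u ∈ Ioc σ t, w u = w t := by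
    intro u hu
    have hu0 : 0 ≤ u := hσ.1.1.trans hu.1.le
    refine hwL u t hu0 hu.2 ht.2 fun x hx => ?_
    exact (hvL x ⟨hu0.trans hx.1, hx.2.trans ht.2⟩).trans_lt (hgt x ⟨hu.1.trans_le hx.1, hx.2⟩)
  have hlim : w σ = w t := by
    have h1 : Tendsto w (𝓝[Ioc σ t] σ) (𝓝 (w σ)) :=
      (hw σ (hsub hσ.1)).mono fun u hu => ⟨hσ.1.1.trans hu.1.le, hu.2.trans ht.2⟩
    have : (𝓝[Ioc σ t] σ).NeBot := by
      rw [nhdsWithin_Ioc_eq_nhdsGT hσt]; infer_instance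
    refine tendsto_nhds_unique h1 (tendsto_const_nhds.congr' ?_)
    exact eventually_mem_nhdsWithin.mono fun u hu => (hconst u hu).symm
  have := hvm (hsub hσ.1) ht hσt.le
  linarith

namespace IsSolution

variable {N : ℕ} {p T a : ℝ} {f : ℝ → EuclideanSpace ℝ (Fin N) →L[ℝ] ℝ}
  {X₁ : ℝ → ℝ → EuclideanSpace ℝ (Fin N)} {X₂ : ℝ → ℝ → EuclideanSpace ℝ (Fin N × Fin N)}
  {y m z n : ℝ → ℝ}

lemma monotoneOn (h : IsSolution p T a f X₁ X₂ y m) : MonotoneOn m (Icc 0 T) := by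
  obtain ⟨μ, hμ, h1, -⟩ := h.reflection
  intro s hs t ht hst
  rw [h1 s hs, h1 t ht]
  exact measureReal_mono (Icc_subset_Icc_right hst)

lemma zero (h : IsSolution p T a f X₁ X₂ y m) (hT : 0 ≤ T) : m 0 = 0 := by
  obtain ⟨μ, hμ, -, h1⟩ := h.reflection
  simpa using h1 0 ⟨le_rfl, hT⟩

/-- The reflection term is constant as long as the solution is positive. -/
lemma eq_of_pos (h : IsSolution p T a f X₁ X₂ y m) {s t : ℝ} (hs : 0 ≤ s) (hst : s ≤ t)
    (ht : t ≤ T) (hy : ∀ u ∈ Icc s t, 0 < y u) : m s = m t := by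
  refine le_antisymm (h.monotoneOn ⟨hs, hst.trans ht⟩ ⟨hs.trans hst, ht⟩ hst) ?_
  have hms := h.nonneg_m s ⟨hs, hst.trans ht⟩
  obtain ⟨μ, hμ, -, h1⟩ := h.reflection
  rw [h1 t ⟨hs.trans hst, ht⟩]
  by_cases hint : IntervalIntegrable ({v : ℝ | y v = 0}.indicator fun _ => (1 : ℝ)) μ 0 t
  · have hsub1 : uIcc 0 s ⊆ uIcc 0 t := by
      rw [uIcc_of_le hs, uIcc_of_le (hs.trans hst)]; exact Icc_subset_Icc_right hst
    have hsub2 : uIcc s t ⊆ uIcc 0 t := by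
      rw [uIcc_of_le hst, uIcc_of_le (hs.trans hst)]; exact Icc_subset_Icc_left hs
    rw [← intervalIntegral.integral_add_adjacent_intervals (hint.mono_set hsub1)
      (hint.mono_set hsub2), ← h1 s ⟨hs, hst.trans ht⟩]
    have : ∫ u in s..t, {v : ℝ | y v = 0}.indicator (fun _ => (1 : ℝ)) u ∂μ
        = ∫ _u in s..t, (0 : ℝ) ∂μ := by
      refine intervalIntegral.integral_congr fun u hu => ?_
      rw [uIcc_of_le hst] at hu
      exact indicator_of_notMem (by simpa using (hy u hu).ne') _
    rw [this]
    simp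
  · rw [intervalIntegral.integral_undef hint]
    exact hms

/-- The remainder of a solution, on a countable cover. -/
lemma exists_remainder (hp : 0 < p) (h : IsSolution p T a f X₁ X₂ y m) :
    ∃ (r : ℝ → ℝ → ℝ) (c d : ℕ → ℝ) (ϖ : ℕ → ℝ → ℝ → ℝ), Icc 0 T ⊆ ⋃ k, Icc (c k) (d k) ∧
      (∀ k, IsControl (ϖ k) (c k) (d k)) ∧
      (∀ k s t, c k ≤ s → s ≤ t → t ≤ d k → |r s t| ≤ ϖ k s t ^ (3 / p)) ∧
      ∀ s t, 0 ≤ s → s ≤ t → t ≤ T → y t - euler f X₁ X₂ s t (y s) = m t - m s + r s t := by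
  obtain ⟨r, ⟨c, d, -, hcov, hr⟩, hexp⟩ := h.expansion
  have hp3 : 0 < p / 3 := by positivity
  refine ⟨r, c, d, fun _ s t => (varControl (p / 3) r s t).toReal, hcov,
    fun k => (hr k).isControl hp3, fun k s t h1 h2 h3 => ?_, fun s t h1 h2 h3 => ?_⟩
  · simpa using (hr k).norm_le hp3 h1 h2 h3
  · have := hexp s t h1 h2 h3
    simp only [incr, euler, term₁, term₂] at this ⊢
    linarith

section Uniqueness

variable {ϖ : ℝ → ℝ → ℝ} {Φ : ℝ → ℝ → ℝ → ℝ} {η B C : ℝ}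

/-- On an interval where the reflection term is monotone, so is the pull-back of the solution. -/
lemma monotoneOn_pullback (hp : 2 ≤ p) (hp3 : p < 3) (h : IsSolution p T a f X₁ X₂ y m)
    (hϖ : IsControl ϖ 0 T) (hη : 0 < η) (hB : 0 < B) (hC : 0 ≤ C)
    (hΦ : IsFlowOf Φ (euler f X₁ X₂) ϖ 0 T η (3 / p) (1 / p) B C) {s t : ℝ} (hs : 0 ≤ s)
    (ht : t ≤ T) :
    MonotoneOn (fun t => Φ t T (y t)) (Icc s t) ∧
      (AntitoneOn m (Icc s t) → AntitoneOn (fun t => Φ t T (y t)) (Icc s t)) := by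
  have hp0 : 0 < p := by linarith
  have hα : 1 < 3 / p := (one_lt_div hp0).2 hp3
  obtain ⟨r, c, d, ϖ', hcov, hc, hr, hexp⟩ := h.exists_remainder hp0
  have hsub : Icc s t ⊆ Icc 0 T := Icc_subset_Icc hs ht
  have hcont : ContinuousOn (fun t => Φ t T (y t)) (Icc s t) :=
    (hΦ.continuousOn_pullback hϖ (by linarith) (by positivity) hη hB hC
      (MemV₁.continuousOn hp0 h.mem_y)).mono hsub
  have hloc := fun k => hΦ.monotoneOn_pullback hϖ hα hη hB hC (c := max (c k) s) (d := min (d k) t)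
    (hs.trans (le_max_right _ _)) ((min_le_right _ _).trans ht) (y := y) (g := m) (r := r)
    ((hc k).restrict (le_max_left _ _) (min_le_left _ _))
    (fun u v i j l => hr k u v ((le_max_left _ _).trans i) j (l.trans (min_le_left _ _)))
    (fun u v i j l => hexp u v (hs.trans ((le_max_right _ _).trans i)) j
      (l.trans ((min_le_right _ _).trans ht)))
  have hinter : ∀ k, Icc (c k) (d k) ∩ Icc s t = Icc (max (c k) s) (min (d k) t) := fun k =>
    Icc_inter_Icc
  have hsub' : ∀ k, Icc (max (c k) s) (min (d k) t) ⊆ Icc s t := fun k =>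
    Icc_subset_Icc (le_max_right _ _) (min_le_right _ _)
  refine ⟨monotoneOn_of_cover c d hcont (hsub.trans hcov) fun k => ?_, fun hm => ?_⟩
  · rw [hinter]
    exact (hloc k).1 (h.monotoneOn.mono ((hsub' k).trans hsub))
  · have := monotoneOn_of_cover c d hcont.neg (hsub.trans hcov) fun k => by
      rw [hinter]
      exact ((hloc k).2 (hm.mono (hsub' k))).neg
    exact fun x hx z hz hxz => neg_le_neg_iff.1 (this hx hz hxz)

lemma pullback_le (hp : 2 ≤ p) (hp3 : p < 3) (h : IsSolution p T a f X₁ X₂ y m)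
    (h' : IsSolution p T a f X₁ X₂ z n)
    (hϖ : IsControl ϖ 0 T) (hη : 0 < η) (hB : 0 < B) (hC : 0 ≤ C)
    (hΦ : IsFlowOf Φ (euler f X₁ X₂) ϖ 0 T η (3 / p) (1 / p) B C) :
    ∀ t ∈ Icc 0 T, Φ t T (y t) ≤ Φ t T (z t) := by
  have hp0 : 0 < p := by linarith
  have hcont : ∀ {y m}, IsSolution p T a f X₁ X₂ y m →
      ContinuousOn (fun t => Φ t T (y t)) (Icc 0 T) := fun h =>
    hΦ.continuousOn_pullback hϖ (by positivity) (by positivity) hη hB hC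
      (MemV₁.continuousOn hp0 h.mem_y)
  refine skorokhod_comparison (L := fun t => Φ t T 0) (hcont h) (hcont h')
    (h'.monotoneOn_pullback hp hp3 hϖ hη hB hC hΦ le_rfl le_rfl).1
    (fun t ht => (hΦ.strictMono hB ht.1 ht.2 le_rfl).monotone (h'.nonneg_y t ht))
    (fun s t hs hst ht hpos => ?_) (by rw [h.initial, h'.initial])
  have hpos' : ∀ u ∈ Icc s t, 0 < y u := fun u hu =>
    (hΦ.strictMono hB (hs.trans hu.1) (hu.2.trans ht) le_rfl).lt_iff_lt.1 (hpos u hu)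
  obtain ⟨h1, h2⟩ := h.monotoneOn_pullback hp hp3 hϖ hη hB hC hΦ hs ht
  refine le_antisymm (h1 ⟨le_rfl, hst⟩ ⟨hst, le_rfl⟩ hst) (h2 ?_ ⟨le_rfl, hst⟩ ⟨hst, le_rfl⟩ hst)
  intro u hu v hv huv
  exact (h.eq_of_pos (hs.trans hu.1) huv (hv.2.trans ht) fun x hx =>
    hpos' x ⟨hu.1.trans hx.1, hx.2.trans hv.2⟩).ge

/-- The reflection terms of two solutions with the same path are comparable. -/
lemma monotoneOn_sub (hp : 2 ≤ p) (hp3 : p < 3) (h : IsSolution p T a f X₁ X₂ y m)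
    (h' : IsSolution p T a f X₁ X₂ z n) (hyz : EqOn y z (Icc 0 T)) :
    MonotoneOn (fun t => m t - n t) (Icc 0 T) := by
  have hp0 : 0 < p := by linarith
  have hα : 1 < 3 / p := (one_lt_div hp0).2 hp3
  obtain ⟨r, c, d, ϖ, hcov, hc, hr, hexp⟩ := h.exists_remainder hp0
  obtain ⟨r', c', d', ϖ', hcov', hc', hr', hexp'⟩ := h'.exists_remainder hp0
  refine monotoneOn_of_cover (ι := ℕ × ℕ) (fun k => max (c k.1) (c' k.2))
    (fun k => min (d k.1) (d' k.2))
    ((MemV₁.continuousOn one_pos h.mem_m).sub (MemV₁.continuousOn one_pos h'.mem_m))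
    (fun x hx => ?_) (fun k => ?_)
  · obtain ⟨i, hi⟩ := mem_iUnion.1 (hcov hx)
    obtain ⟨j, hj⟩ := mem_iUnion.1 (hcov' hx)
    exact mem_iUnion.2 ⟨(i, j), max_le hi.1 hj.1, le_min hi.2 hj.2⟩
  · rw [Icc_inter_Icc]
    have l1 : c k.1 ≤ max (max (c k.1) (c' k.2)) 0 := (le_max_left _ _).trans (le_max_left _ _)
    have l2 : c' k.2 ≤ max (max (c k.1) (c' k.2)) 0 := (le_max_right _ _).trans (le_max_left _ _)
    have l3 : min (min (d k.1) (d' k.2)) T ≤ d k.1 := (min_le_left _ _).trans (min_le_left _ _)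
    have l4 : min (min (d k.1) (d' k.2)) T ≤ d' k.2 := (min_le_left _ _).trans (min_le_right _ _)
    have hsum := ((hc k.1).restrict l1 l3).add ((hc' k.2).restrict l2 l4)
    refine hsum.monotoneOn_of_le_rpow hα one_pos (zero_le_two) fun s t i j l _ => ?_
    have s0 : 0 ≤ s := (le_max_right _ _).trans i
    have tT : t ≤ T := l.trans (min_le_right _ _)
    have e1 := hexp s t s0 j tT
    have e2 := hexp' s t s0 j tT
    rw [← hyz ⟨s0, j.trans tT⟩, ← hyz ⟨s0.trans j, tT⟩] at e2
    have b1 := hr k.1 s t (l1.trans i) j (l.trans l3)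
    have b2 := hr' k.2 s t (l2.trans i) j (l.trans l4)
    have n1 := (hc k.1).nonneg s t (l1.trans i) j (l.trans l3)
    have n2 := (hc' k.2).nonneg s t (l2.trans i) j (l.trans l4)
    have g1 : ϖ k.1 s t ^ (3 / p) ≤ (ϖ k.1 s t + ϖ' k.2 s t) ^ (3 / p) := by gcongr; linarith
    have g2 : ϖ' k.2 s t ^ (3 / p) ≤ (ϖ k.1 s t + ϖ' k.2 s t) ^ (3 / p) := by gcongr; linarith
    have a1 := le_abs_self (r s t)
    have a2 := neg_abs_le (r' s t)
    linarith

end Uniqueness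

end IsSolution

/-- Uniqueness of the reflected equation. -/
lemma IsSolution.unique {N : ℕ} {p T a : ℝ} {f : ℝ → EuclideanSpace ℝ (Fin N) →L[ℝ] ℝ}
    {X₁ : ℝ → ℝ → EuclideanSpace ℝ (Fin N)} {X₂ : ℝ → ℝ → EuclideanSpace ℝ (Fin N × Fin N)}
    {y m z n : ℝ → ℝ} (hp : 2 ≤ p) (hp3 : p < 3) (hT : 0 < T) (hf : IsCb3 f)
    (hX : IsGeometricRoughPath p T X₁ X₂) (h : IsSolution p T a f X₁ X₂ y m)
    (h' : IsSolution p T a f X₁ X₂ z n) : EqOn y z (Icc 0 T) ∧ EqOn m n (Icc 0 T) := by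
  obtain ⟨ϖ, Φ, η, B, C, hϖ, hη, hB, hC, hΦ⟩ := hX.exists_flow hp hp3 hf
  have hyz : EqOn y z (Icc 0 T) := fun t ht =>
    (hΦ.strictMono hB ht.1 ht.2 le_rfl).injective
      (le_antisymm (h.pullback_le hp hp3 h' hϖ hη hB hC hΦ t ht)
        (h'.pullback_le hp hp3 h hϖ hη hB hC hΦ t ht))
  refine ⟨hyz, fun t ht => ?_⟩
  have h0 : (0 : ℝ) ∈ Icc 0 T := ⟨le_rfl, hT.le⟩
  have h1 := h.monotoneOn_sub hp hp3 h' hyz h0 ht ht.1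
  have h2 := h'.monotoneOn_sub hp hp3 h hyz.symm h0 ht ht.1
  simp only [h.zero hT.le, h'.zero hT.le] at h1 h2
  linarith

/-! ### Existence -/

/-- Solution of the Skorokhod problem with a continuous obstacle, for a constant path. -/
lemma exists_skorokhod {L : ℝ → ℝ} {T w₀ : ℝ} (hT : 0 ≤ T) (hL : ContinuousOn L (Icc 0 T))
    (h0 : L 0 ≤ w₀) : ∃ w : ℝ → ℝ, ContinuousOn w (Icc 0 T) ∧ MonotoneOn w (Icc 0 T) ∧
      (∀ t ∈ Icc 0 T, L t ≤ w t) ∧ w 0 = w₀ ∧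
      ∀ s t, 0 ≤ s → s ≤ t → t ≤ T → (∀ u ∈ Icc s t, L u < w u) → w s = w t := by
  set L' : ℝ → ℝ := fun s => L (max 0 (min T s))
  have hL' : Continuous L' := hL.comp_continuous (by fun_prop) fun x =>
    ⟨le_max_left _ _, max_le hT (min_le_left _ _)⟩
  have hLL : ∀ s ∈ Icc 0 T, L' s = L s := fun s hs => by
    simp only [L']
    rw [min_eq_right hs.2, max_eq_right hs.1]
  set R : ℝ → ℝ := fun t => sSup ((fun θ => L' (θ * t)) '' Icc 0 1)
  have hR : Continuous R := isCompact_Icc.continuous_sSup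
    (f := fun t θ => L' (θ * t)) (by simp only [Function.HasUncurry.uncurry, id]; fun_prop)
  have hRle : ∀ s t, 0 ≤ s → s ≤ t → t ≤ T → L s ≤ R t := by
    intro s t hs hst ht
    have hbdd : BddAbove ((fun θ => L' (θ * t)) '' Icc 0 1) :=
      isCompact_Icc.bddAbove_image (Continuous.continuousOn (by fun_prop))
    obtain ⟨θ, hθ, hθ'⟩ : ∃ θ ∈ Icc (0 : ℝ) 1, θ * t = s := by
      rcases (hs.trans hst).eq_or_lt with h | h
      · exact ⟨0, ⟨le_rfl, zero_le_one⟩, by linarith⟩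
      · exact ⟨s / t, ⟨by positivity, (div_le_one h).2 hst⟩, div_mul_cancel₀ _ h.ne'⟩
    rw [← hLL s ⟨hs, hst.trans ht⟩, ← hθ']
    exact le_csSup hbdd ⟨θ, hθ, rfl⟩
  have hRex : ∀ t, 0 ≤ t → t ≤ T → ∃ s, 0 ≤ s ∧ s ≤ t ∧ R t = L s := by
    intro t h0 ht
    obtain ⟨θ, hθ, hθ'⟩ := isCompact_Icc.exists_sSup_image_eq (nonempty_Icc.2 zero_le_one)
      (Continuous.continuousOn (s := Icc (0 : ℝ) 1) (f := fun θ => L' (θ * t)) (by fun_prop))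
    have h1 : 0 ≤ θ * t := mul_nonneg hθ.1 h0
    have h2 : θ * t ≤ t := mul_le_of_le_one_left h0 hθ.2
    exact ⟨θ * t, h1, h2, hθ'.trans (hLL _ ⟨h1, h2.trans ht⟩)⟩
  have hRm : ∀ s t, 0 ≤ s → s ≤ t → t ≤ T → R s ≤ R t := by
    intro s t hs hst ht
    obtain ⟨u, h1, h2, h3⟩ := hRex s hs (hst.trans ht)
    rw [h3]
    exact hRle u t h1 (h2.trans hst) ht
  have hwm : MonotoneOn (fun t => max w₀ (R t)) (Icc 0 T) := fun s hs t ht hst =>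
    max_le_max le_rfl (hRm s t hs.1 hst ht.2)
  refine ⟨fun t => max w₀ (R t), (by fun_prop : Continuous _).continuousOn, hwm,
    fun t ht => (hRle t t ht.1 le_rfl ht.2).trans (le_max_right _ _), ?_, ?_⟩
  · obtain ⟨s, h1, h2, h3⟩ := hRex 0 le_rfl hT
    obtain rfl : s = 0 := le_antisymm h2 h1
    dsimp only
    rw [h3, max_eq_left h0]
  · intro s t hs hst ht hpos
    refine le_antisymm (hwm ⟨hs, hst.trans ht⟩ ⟨hs.trans hst, ht⟩ hst) ?_
    refine max_le (le_max_left _ _) ?_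
    obtain ⟨u, h1, h2, h3⟩ := hRex t (hs.trans hst) ht
    rcases le_total u s with h | h
    · rw [h3]
      exact (hRle u s h1 h (hst.trans ht)).trans (le_max_right _ _)
    · have h4 := hpos u ⟨h, h2⟩
      have h5 := hwm ⟨h1, h2.trans ht⟩ ⟨hs.trans hst, ht⟩ h2
      have h6 : R t ≤ w₀ := by
        by_contra! h7
        simp only at h4 h5
        rw [max_eq_right h7.le, h3] at h5
        linarith
      exact h6.trans (le_max_left _ _)

/-- The measure associated with a continuous nondecreasing path which only grows when `y = 0`. -/
lemma exists_reflection_measure {y m : ℝ → ℝ} {T : ℝ} (hT : 0 ≤ T) (hm : MonotoneOn m (Icc 0 T))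
    (hmc : ContinuousOn m (Icc 0 T)) (hm0 : m 0 = 0) (hy : ContinuousOn y (Icc 0 T))
    (hconst : ∀ s t, 0 ≤ s → s ≤ t → t ≤ T → (∀ u ∈ Icc s t, y u ≠ 0) → m s = m t) :
    ∃ μ : Measure ℝ, IsFiniteMeasure μ ∧ (∀ t ∈ Icc 0 T, m t = μ.real (Icc 0 t)) ∧
      ∀ t ∈ Icc 0 T, m t =
        ∫ u in (0 : ℝ)..t, {v : ℝ | y v = 0}.indicator (fun _ => (1 : ℝ)) u ∂μ := by
  set m' : ℝ → ℝ := fun x => m (max 0 (min T x))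
  have hproj : ∀ x : ℝ, max 0 (min T x) ∈ Icc 0 T := fun x =>
    ⟨le_max_left _ _, max_le hT (min_le_left _ _)⟩
  have hmm : ∀ x ∈ Icc 0 T, m' x = m x := fun x hx => by
    simp only [m']
    rw [min_eq_right hx.2, max_eq_right hx.1]
  have hc : Continuous m' := hmc.comp_continuous (by fun_prop) hproj
  let F : StieltjesFunction ℝ :=
    ⟨m', fun x y hxy => hm (hproj x) (hproj y) (max_le_max le_rfl (min_le_min le_rfl hxy)),
      fun x => hc.continuousWithinAt⟩
  have hF : ∀ x ∈ Icc 0 T, F x = m x := hmm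
  have hIcc : ∀ s t, 0 ≤ s → s ≤ t → t ≤ T →
      F.measure.restrict (Icc 0 T) (Icc s t) = ENNReal.ofReal (m t - m s) := by
    intro s t hs hst ht
    have h1 : Function.leftLim F s = F s := hc.continuousWithinAt.leftLim_eq
    rw [Measure.restrict_apply measurableSet_Icc, inter_eq_left.2 (Icc_subset_Icc hs ht),
      F.measure_Icc, h1, hF s ⟨hs, hst.trans ht⟩, hF t ⟨hs.trans hst, ht⟩]
  have hIoc : ∀ t, 0 ≤ t → t ≤ T →
      F.measure.restrict (Icc 0 T) (Ioc 0 t) = ENNReal.ofReal (m t) := by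
    intro t h0 ht
    rw [Measure.restrict_apply measurableSet_Ioc,
      inter_eq_left.2 (Ioc_subset_Icc_self.trans (Icc_subset_Icc le_rfl ht)),
      F.measure_Ioc, hF 0 ⟨le_rfl, hT⟩, hF t ⟨h0, ht⟩, hm0, sub_zero]
  have hnonneg : ∀ t, 0 ≤ t → t ≤ T → 0 ≤ m t := fun t h0 ht => by
    rw [← hm0]; exact hm ⟨le_rfl, hT⟩ ⟨h0, ht⟩ h0
  set μ := F.measure.restrict (Icc 0 T)
  have hnull : μ {v | v ∈ Icc 0 T ∧ y v ≠ 0} = 0 := by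
    refine measure_null_of_locally_null _ fun x hx => ?_
    have h1 : ∀ᶠ v in 𝓝[Icc 0 T] x, y v ≠ 0 := (hy x hx.1).eventually_ne hx.2
    obtain ⟨ε, hε, h2⟩ := Metric.mem_nhdsWithin_iff.1 h1
    have hs : max 0 (x - ε / 2) ≤ x := max_le hx.1.1 (by linarith)
    have ht : x ≤ min T (x + ε / 2) := le_min hx.1.2 (by linarith)
    refine ⟨Icc (max 0 (x - ε / 2)) (min T (x + ε / 2)), ?_, ?_⟩
    · refine mem_nhdsWithin.2 ⟨Ioo (x - ε / 2) (x + ε / 2), isOpen_Ioo,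
        ⟨by linarith, by linarith⟩, ?_⟩
      rintro v ⟨hv1, hv2⟩
      exact ⟨max_le hv2.1.1 hv1.1.le, le_min hv2.1.2 hv1.2.le⟩
    · rw [hIcc _ _ (le_max_left _ _) (hs.trans ht) (min_le_left _ _),
        hconst _ _ (le_max_left _ _) (hs.trans ht) (min_le_left _ _), sub_self,
        ENNReal.ofReal_zero]
      intro u hu
      refine h2 ⟨?_, (le_max_left _ _).trans hu.1, hu.2.trans (min_le_left _ _)⟩
      have h3 := (le_max_right _ _).trans hu.1
      have h4 := hu.2.trans (min_le_right _ _)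
      rw [Metric.mem_ball, Real.dist_eq, abs_lt]
      constructor <;> linarith
  refine ⟨μ, ⟨?_⟩, fun t ht => ?_, fun t ht => ?_⟩
  · rw [Measure.restrict_apply_univ]
    exact isCompact_Icc.measure_lt_top
  · rw [measureReal_def, hIcc 0 t le_rfl ht.1 ht.2, hm0, sub_zero,
      ENNReal.toReal_ofReal (hnonneg t ht.1 ht.2)]
  · rw [intervalIntegral.integral_of_le ht.1]
    have hae : ∀ᵐ u ∂μ, u ∈ Ioc 0 t → {v : ℝ | y v = 0}.indicator (fun _ => (1 : ℝ)) u = 1 := by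
      rw [ae_iff]
      refine measure_mono_null (fun u hu => ?_) hnull
      simp only [mem_ofPred_eq, Classical.not_imp] at hu
      refine ⟨⟨hu.1.1.le, hu.1.2.trans ht.2⟩, fun h => hu.2 ?_⟩
      exact indicator_of_mem (show u ∈ {v : ℝ | y v = 0} from h) _
    rw [setIntegral_congr_ae measurableSet_Ioc hae, setIntegral_const, measureReal_def,
      hIoc t ht.1 ht.2, ENNReal.toReal_ofReal (hnonneg t ht.1 ht.2)]
    simp

/-- The additive sewing lemma, as a special case of the sewing of flows: an almost additive
two-index map is close to the increments of a path. -/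
lemma exists_sewing {ϖ : ℝ → ℝ → ℝ} {M : ℝ → ℝ → ℝ} {T η α B K : ℝ} (hϖ : IsControl ϖ 0 T)
    (hη : 0 < η) (hα : 1 < α) (hB : 0 ≤ B) (hK : 0 ≤ K) (hM0 : ∀ s, 0 ≤ s → s ≤ T → M s s = 0)
    (hM : ∀ s t, 0 ≤ s → s ≤ t → t ≤ T → |M s t| ≤ B * ϖ s t)
    (hadd : ∀ s u t, 0 ≤ s → s ≤ u → u ≤ t → t ≤ T → t - s ≤ η →
      |M s u + M u t - M s t| ≤ K * ϖ s t ^ α) :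
    ∃ (m : ℝ → ℝ) (η' C : ℝ), 0 < η' ∧ 0 ≤ C ∧ m 0 = 0 ∧ ContinuousOn m (Icc 0 T) ∧
      ∀ s t, 0 ≤ s → s ≤ t → t ≤ T → t - s ≤ η' → |m t - m s - M s t| ≤ C * ϖ s t ^ α := by
  rcases lt_or_ge T 0 with hT | hT
  · exact ⟨fun _ => 0, 1, 0, one_pos, le_rfl, rfl, continuousOn_const,
      fun s t h1 h2 h3 => by linarith⟩
  have hμ : IsApproxFlow (fun s t x => x + M s t) ϖ 0 T η α 1 B K := by
    refine ⟨?_, ?_, ?_, ?_, ?_, ?_⟩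
    · intro s x h1 h2
      simp [hM0 s h1 h2]
    · intro s t h1 h2 h3 _ x
      simpa using hM s t h1 h2 h3
    · intro s t h1 h2 h3 _ x y
      have := hϖ.nonneg s t h1 h2 h3
      simpa using (by positivity : 0 ≤ B * ϖ s t * |x - y|)
    · intro s t h1 h2 h3 _ x x' y y'
      have := hϖ.nonneg s t h1 h2 h3
      simpa using (by positivity :
        0 ≤ B * ϖ s t * (|x - x' - (y - y')| + |x - x'| * (|x - y| + |x' - y'|)))
    · intro s u t h1 h2 h3 h4 h5 x
      refine le_trans (le_of_eq ?_) (hadd s u t h1 h2 h3 h4 h5)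
      congr 1; ring
    · intro s u t h1 h2 h3 h4 h5 x y
      have := hϖ.nonneg s t h1 (h2.trans h3) h4
      have e : (x + M s u + M u t - (x + M s t)) - (y + M s u + M u t - (y + M s t)) = 0 := by ring
      rw [e, abs_zero]
      positivity
  obtain ⟨Ψ, η', B', C, hη', hB', hC, hΨ⟩ := hμ.exists_flow hϖ hη hα one_pos hB hK
  have hstep : ∀ s t, 0 ≤ s → s ≤ t → t ≤ T → Ψ 0 t 0 = Ψ s t (Ψ 0 s 0) := fun s t h1 h2 h3 =>
    (hΨ.comp 0 s t le_rfl h1 h2 h3 0).symm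
  refine ⟨fun t => Ψ 0 t 0, η', C, hη', hC, hΨ.self 0 0 le_rfl hT,
    continuousOn_of_modulus fun ε hε => ?_, fun s t h1 h2 h3 h4 => ?_⟩
  · obtain ⟨η'', h4, h5⟩ := hΨ.exists_disp_le hϖ (by linarith) one_pos hη' hC hε
    refine ⟨η'', h4, fun s t h1 h2 h3 h6 => ?_⟩
    rw [hstep s t h1 h2 h3]
    exact h5 s t h1 h2 h3 h6 _
  · dsimp only
    rw [hstep s t h1 h2 h3, sub_sub]
    exact hΨ.close s t h1 h2 h3 h4 _

/-- Existence for the reflected equation. -/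
lemma exists_isSolution {N : ℕ} {p T a : ℝ} (hp : 2 ≤ p) (hp3 : p < 3) (hT : 0 < T) (ha : 0 ≤ a)
    {f : ℝ → EuclideanSpace ℝ (Fin N) →L[ℝ] ℝ} (hf : IsCb3 f)
    {X₁ : ℝ → ℝ → EuclideanSpace ℝ (Fin N)} {X₂ : ℝ → ℝ → EuclideanSpace ℝ (Fin N × Fin N)}
    (hX : IsGeometricRoughPath p T X₁ X₂) : ∃ y m : ℝ → ℝ, IsSolution p T a f X₁ X₂ y m := by
  obtain ⟨ϖ, Φ, η, B, C, hϖ, hη, hB, hC, hΦ⟩ := hX.exists_flow hp hp3 hf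
  have hp0 : 0 < p := by linarith
  have hβ : 0 < 1 / p := one_div_pos.2 hp0
  have hα : 1 < 3 / p := (one_lt_div hp0).2 hp3
  have hβα : 1 / p ≤ 3 / p := by gcongr; norm_num
  have hβ1 : 1 / p ≤ 1 := (div_le_one hp0).2 (by linarith)
  have hα' : 3 / p ≤ 1 / p + 1 := by
    rw [div_add_one hp0.ne']; gcongr; linarith
  -- the path, pulled back by the flow to the terminal time
  obtain ⟨w, hwc, hwm, hwL, hw0, hwconst⟩ := exists_skorokhod (L := fun t => Φ t T 0)
    (w₀ := Φ 0 T a) hT.le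
    (hΦ.continuousOn_pullback hϖ (by linarith) hβ hη hB hC continuousOn_const)
    ((hΦ.strictMono hB le_rfl hT.le le_rfl).monotone ha)
  have hsurj : ∀ t ∈ Icc 0 T, ∃ x, Φ t T x = w t := by
    intro t ht
    refine (hΦ.continuous hB ht.1 ht.2 le_rfl).surjective ?_ ?_ (w t)
    · refine tendsto_atTop_mono (fun x => ?_) (tendsto_atTop_add_const_right _ (-B) tendsto_id)
      have := (abs_le.1 (hΦ.disp t T ht.1 ht.2 le_rfl x)).1
      simp only [id]
      linarith
    · refine tendsto_atBot_mono (fun x => ?_) (tendsto_atBot_add_const_right _ B tendsto_id)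
      have := (abs_le.1 (hΦ.disp t T ht.1 ht.2 le_rfl x)).2
      simp only [id]
      linarith
  choose! y hyw using hsurj
  have hy0 : ∀ t ∈ Icc 0 T, 0 ≤ y t := fun t ht =>
    (hΦ.strictMono hB ht.1 ht.2 le_rfl).le_iff_le.1 ((hwL t ht).trans (hyw t ht).ge)
  have hya : y 0 = a := (hΦ.strictMono hB le_rfl hT.le le_rfl).injective
    ((hyw 0 ⟨le_rfl, hT.le⟩).trans hw0)
  have hyΦ : ∀ s t, 0 ≤ s → s ≤ t → t ≤ T → Φ s t (y s) ≤ y t := by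
    intro s t h1 h2 h3
    refine (hΦ.strictMono hB (h1.trans h2) h3 le_rfl).le_iff_le.1 ?_
    rw [hΦ.comp s t T h1 h2 h3 le_rfl, hyw t ⟨h1.trans h2, h3⟩, hyw s ⟨h1, h2.trans h3⟩]
    exact hwm ⟨h1, h2.trans h3⟩ ⟨h1.trans h2, h3⟩ h2
  have hyw' : ∀ s t, 0 ≤ s → s ≤ t → t ≤ T → y t - Φ s t (y s) ≤ B * (w t - w s) := by
    intro s t h1 h2 h3
    have := hΦ.lower t T (h1.trans h2) h3 le_rfl _ _ (hyΦ s t h1 h2 h3)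
    rwa [hΦ.comp s t T h1 h2 h3 le_rfl, hyw t ⟨h1.trans h2, h3⟩, hyw s ⟨h1, h2.trans h3⟩] at this
  -- the control
  have hκw := IsControl.of_monotoneOn hwm hwc
  obtain ⟨κ, hκ, hϖκ, hwκ⟩ : ∃ κ : ℝ → ℝ → ℝ, IsControl κ 0 T ∧
      (∀ s t, 0 ≤ s → s ≤ t → t ≤ T → ϖ s t ≤ κ s t) ∧
      ∀ s t, 0 ≤ s → s ≤ t → t ≤ T → w t - w s ≤ κ s t :=
    ⟨_, hϖ.add hκw, fun s t h1 h2 h3 => le_add_of_nonneg_right (hκw.nonneg s t h1 h2 h3),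
      fun s t h1 h2 h3 => le_add_of_nonneg_left (hϖ.nonneg s t h1 h2 h3)⟩
  obtain ⟨η₁, hη₁, hκ1⟩ := hκ.regular 1 one_pos
  have hpow : ∀ s t, 0 ≤ s → s ≤ t → t ≤ T → t - s ≤ min η η₁ →
      ϖ s t ^ (1 / p) ≤ κ s t ^ (1 / p) ∧ ϖ s t ^ (3 / p) ≤ κ s t ^ (3 / p) ∧
      κ s t ^ (3 / p) ≤ κ s t ^ (1 / p) ∧ κ s t ≤ κ s t ^ (1 / p) ∧
      κ s t ^ (1 / p + 1) ≤ κ s t ^ (3 / p) := by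
    intro s t h1 h2 h3 h4
    have k0 := hκ.nonneg s t h1 h2 h3
    have k1 := hκ1 s t h1 h2 h3 (h4.trans (min_le_right _ _))
    have k2 := hϖ.nonneg s t h1 h2 h3
    have k3 := hϖκ s t h1 h2 h3
    refine ⟨by gcongr, by gcongr, Real.rpow_le_rpow_of_exponent_ge' k0 k1 hβ.le hβα, ?_,
      Real.rpow_le_rpow_of_exponent_ge' k0 k1 (by positivity) hα'⟩
    simpa using Real.rpow_le_rpow_of_exponent_ge' k0 k1 hβ.le hβ1
  -- the reflection term
  obtain ⟨m, η₂, C', hη₂, hC', hm0, hmc, hmM⟩ := exists_sewing (M := fun s t => y t - Φ s t (y s))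
    (η := min η η₁) (α := 1 / p + 1) (B := B) (K := 2 * C * B) hκ (by positivity) (by linarith)
    hB.le (by positivity)
    (fun s h1 h2 => by simp [hΦ.self s (y s) h1 h2])
    (fun s t h1 h2 h3 => by
      rw [abs_of_nonneg (sub_nonneg.2 (hyΦ s t h1 h2 h3))]
      exact (hyw' s t h1 h2 h3).trans (mul_le_mul_of_nonneg_left (hwκ s t h1 h2 h3) hB.le))
    (fun s u t h1 h2 h3 h4 h5 => by
      have hut : t - u ≤ min η η₁ := by linarith
      have e : y u - Φ s u (y s) + (y t - Φ u t (y u)) - (y t - Φ s t (y s)) =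
          -((Φ u t (y u) - y u) - (Φ u t (Φ s u (y s)) - Φ s u (y s))) := by
        rw [hΦ.comp s u t h1 h2 h3 h4]; ring
      rw [e, abs_neg]
      refine (hΦ.lip u t (h1.trans h2) h3 h4 (hut.trans (min_le_left _ _)) _ _).trans ?_
      obtain ⟨i1, i2, i3, -, -⟩ := hpow u t (h1.trans h2) h3 h4 hut
      have k0 := hκ.nonneg s t h1 (h2.trans h3) h4
      have k1 : κ u t ^ (1 / p) ≤ κ s t ^ (1 / p) := by
        have := hκ.nonneg u t (h1.trans h2) h3 h4
        have := hκ.mono h1 h2 h3 le_rfl h4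
        gcongr
      have k2 : |y u - Φ s u (y s)| ≤ B * κ s t := by
        rw [abs_of_nonneg (sub_nonneg.2 (hyΦ s u h1 h2 (h3.trans h4)))]
        refine (hyw' s u h1 h2 (h3.trans h4)).trans (mul_le_mul_of_nonneg_left ?_ hB.le)
        exact (hwκ s u h1 h2 (h3.trans h4)).trans (hκ.mono h1 le_rfl h2 h3 h4)
      calc C * (ϖ u t ^ (1 / p) + ϖ u t ^ (3 / p)) * |y u - Φ s u (y s)|
          ≤ C * (2 * κ s t ^ (1 / p)) * (B * κ s t) := by
            refine mul_le_mul (mul_le_mul_of_nonneg_left (by linarith) hC) k2 (abs_nonneg _)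
              (by positivity)
        _ = 2 * C * B * (κ s t ^ (1 / p) * κ s t) := by ring
        _ = 2 * C * B * κ s t ^ (1 / p + 1) := by
            rw [Real.rpow_add_of_nonneg k0 hβ.le zero_le_one, Real.rpow_one])
  have hmm : MonotoneOn m (Icc 0 T) := by
    refine hκ.monotoneOn_of_le_rpow (α := 1 / p + 1) (by linarith) hη₂ hC'
      fun s t h1 h2 h3 h4 => ?_
    have i1 := (abs_le.1 (hmM s t h1 h2 h3 h4)).1
    have i2 := hyΦ s t h1 h2 h3
    linarith
  have hmconst : ∀ s t, 0 ≤ s → s ≤ t → t ≤ T → (∀ u ∈ Icc s t, y u ≠ 0) → m s = m t := by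
    intro s t h1 h2 h3 hpos
    refine le_antisymm (hmm ⟨h1, h2.trans h3⟩ ⟨h1.trans h2, h3⟩ h2) ?_
    have hanti : MonotoneOn (fun t => -m t) (Icc s t) := by
      refine (hκ.restrict h1 h3).monotoneOn_of_le_rpow (α := 1 / p + 1) (by linarith) hη₂ hC'
        fun u v j1 j2 j3 j4 => ?_
      have u0 := h1.trans j1
      have vT := j3.trans h3
      have i1 := (abs_le.1 (hmM u v u0 j2 vT j4)).2
      have i2 := hyw' u v u0 j2 vT
      have i3 : w u = w v := hwconst u v u0 j2 vT fun x hx => by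
        have hx' : x ∈ Icc 0 T := ⟨u0.trans hx.1, hx.2.trans vT⟩
        rw [← hyw x hx']
        exact hΦ.strictMono hB hx'.1 hx'.2 le_rfl ((hy0 x hx').lt_of_ne'
          (hpos x ⟨j1.trans hx.1, hx.2.trans j3⟩))
      rw [i3, sub_self, mul_zero] at i2
      linarith
    have := hanti ⟨le_rfl, h2⟩ ⟨h2, le_rfl⟩ h2
    simpa using this
  have hmem_y : MemV₁ p y 0 T := by
    refine MemV₂.of_local_control (η := min η η₁) (M := B * (w T - w 0) + B)
      (ϖ := fun s t => (B + 2 * C) ^ p * κ s t) hp0 hT.le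
      (hκ.const_mul (by positivity)) (by positivity) (fun s t h1 h2 h3 => ?_)
      (fun s t h1 h2 h3 h4 => ?_)
    · have i1 := hyw' s t h1 h2 h3
      have i2 := hyΦ s t h1 h2 h3
      have i3 := mul_le_mul_of_nonneg_left (hκw.mono le_rfl h1 h2 h3 le_rfl) hB.le
      obtain ⟨i4, i5⟩ := abs_le.1 (hΦ.disp s t h1 h2 h3 (y s))
      have i6 := mul_nonneg hB.le (hκw.nonneg 0 T le_rfl hT.le le_rfl)
      rw [incr, Real.norm_eq_abs, abs_le]
      constructor <;> linarith
    · have i1 := hyw' s t h1 h2 h3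
      have i2 := hyΦ s t h1 h2 h3
      have i3 := mul_le_mul_of_nonneg_left (hwκ s t h1 h2 h3) hB.le
      obtain ⟨i4, i5⟩ := abs_le.1 (hΦ.disp_le s t h1 h2 h3 (h4.trans (min_le_left _ _)) (y s))
      obtain ⟨j1, j2, j3, j4, -⟩ := hpow s t h1 h2 h3 h4
      have k0 := hκ.nonneg s t h1 h2 h3
      have l1 := mul_le_mul_of_nonneg_left j4 hB.le
      have l2 := mul_le_mul_of_nonneg_left
        (show ϖ s t ^ (1 / p) + ϖ s t ^ (3 / p) ≤ 2 * κ s t ^ (1 / p) by linarith) hC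
      have l3 : 0 ≤ B * κ s t ^ (1 / p) := by positivity
      have key : ‖incr y s t‖ ≤ (B + 2 * C) * κ s t ^ (1 / p) := by
        rw [incr, Real.norm_eq_abs, abs_le]
        constructor <;> linarith
      refine (Real.rpow_le_rpow (norm_nonneg _) key hp0.le).trans (le_of_eq ?_)
      rw [Real.mul_rpow (by positivity) (by positivity), ← Real.rpow_mul k0,
        one_div_mul_cancel hp0.ne', Real.rpow_one]
  refine ⟨y, m, hmem_y, hy0, ?_, fun t ht => ?_, ?_, hya,
    exists_reflection_measure hT.le hmm hmc hm0 (MemV₁.continuousOn hp0 hmem_y) hmconst⟩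
  · refine MemV₂.of_control one_pos hT.le (IsControl.of_monotoneOn hmm hmc)
      fun s t h1 h2 h3 => ?_
    rw [Real.rpow_one, incr, Real.norm_eq_abs,
      abs_of_nonneg (sub_nonneg.2 (hmm ⟨h1, h2.trans h3⟩ ⟨h1.trans h2, h3⟩ h2))]
  · rw [← hm0]
    exact hmm ⟨le_rfl, hT.le⟩ ht ht.1
  · refine ⟨fun s t => y t - euler f X₁ X₂ s t (y s) - (m t - m s), ?_, fun s t _ _ _ => by
      simp only [incr, euler, term₁, term₂]; ring⟩
    set h := min (min η η₁) η₂
    have hh : 0 < h := by positivity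
    have hcT : ∀ k : ℕ, (0 : ℝ) ≤ min T (k * h) := fun k => le_min hT.le (by positivity)
    refine ⟨fun k => min T (k * h), fun k => min T ((k + 1 : ℕ) * h), fun k => ?_, fun x hx => ?_,
      fun k => ?_⟩
    · exact Icc_subset_Icc (hcT k) (min_le_left _ _)
    · refine mem_iUnion.2 ⟨⌊x / h⌋₊, (min_le_right _ _).trans ?_, le_min hx.2 ?_⟩
      · rw [← le_div_iff₀ hh]
        exact Nat.floor_le (div_nonneg hx.1 hh.le)
      · rw [← div_le_iff₀ hh]
        exact_mod_cast (Nat.lt_floor_add_one (x / h)).le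
    · have hq : 0 < p / 3 := by positivity
      have hlen : ∀ s t, min T (k * h) ≤ s → t ≤ min T ((k + 1 : ℕ) * h) → t - s ≤ h := by
        intro s t h1 h2
        push_cast at h2
        rcases le_total T (k * h) with h5 | h5
        · rw [min_eq_left h5] at h1
          linarith [h2.trans (min_le_left _ _)]
        · rw [min_eq_right h5] at h1
          linarith [h2.trans (min_le_right _ _)]
      refine MemV₂.of_control (ϖ := fun s t => (C' + C) ^ (p / 3) * κ s t) hq ?_
        ((hκ.restrict (hcT k) (min_le_left _ _)).const_mul (by positivity)) fun s t j1 h2 j3 => ?_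
      · exact min_le_min le_rfl (by gcongr; simp)
      · have h4 := hlen s t j1 j3
        have h1 := (hcT k).trans j1
        have h3 := j3.trans (min_le_left _ _)
        have i1 := hmM s t h1 h2 h3 (h4.trans (min_le_right _ _))
        have h5 := h4.trans (min_le_left (min η η₁) η₂)
        have i2 := hΦ.close s t h1 h2 h3 (h5.trans (min_le_left _ _)) (y s)
        obtain ⟨-, l2, -, -, l5⟩ := hpow s t h1 h2 h3 h5
        have k0 := hκ.nonneg s t h1 h2 h3
        have n1 := mul_le_mul_of_nonneg_left l5 hC'
        have n2 := mul_le_mul_of_nonneg_left l2 hC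
        have key : ‖y t - euler f X₁ X₂ s t (y s) - (m t - m s)‖ ≤
            (C' + C) * κ s t ^ (3 / p) := by
          rw [Real.norm_eq_abs, show y t - euler f X₁ X₂ s t (y s) - (m t - m s) =
            (Φ s t (y s) - euler f X₁ X₂ s t (y s)) - (m t - m s - (y t - Φ s t (y s))) by ring]
          refine (abs_sub _ _).trans ?_
          linarith
        refine (Real.rpow_le_rpow (norm_nonneg _) key hq.le).trans (le_of_eq ?_)
        rw [Real.mul_rpow (by positivity) (by positivity), ← Real.rpow_mul k0,
          show 3 / p * (p / 3) = 1 by field_simp, Real.rpow_one]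

end ReflectedRDE

theorem theorem2p4 (N : ℕ) (hN : 1 ≤ N) (p T a : ℝ) (hp : 2 ≤ p) (hp3 : p < 3) (hT : 0 < T)
    (ha : 0 < a) (f : ℝ → EuclideanSpace ℝ (Fin N) →L[ℝ] ℝ) (hf : ReflectedRDE.IsCb3 f)
    (X₁ : ℝ → ℝ → EuclideanSpace ℝ (Fin N)) (X₂ : ℝ → ℝ → EuclideanSpace ℝ (Fin N × Fin N))
    (hX : ReflectedRDE.IsGeometricRoughPath p T X₁ X₂) :
    (∃ y m : ℝ → ℝ, ReflectedRDE.IsSolution p T a f X₁ X₂ y m) ∧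
      ∀ y m z n : ℝ → ℝ, ReflectedRDE.IsSolution p T a f X₁ X₂ y m →
        ReflectedRDE.IsSolution p T a f X₁ X₂ z n →
        Set.EqOn y z (Set.Icc 0 T) ∧ Set.EqOn m n (Set.Icc 0 T) := by
  exact ⟨ReflectedRDE.exists_isSolution hp hp3 hT ha.le hf hX,
    fun _ _ _ _ h h' => h.unique hp hp3 hT hf hX h'⟩
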